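/- Let $(R,\mathfrak m)$ be a Noetherian local ring of Krull dimension $d$ with $0<d$, and let $q\ge 1$. For $k=1,\dots,q$ let $F_k$ be a free $R$-module of finite rank $r_k$ and let $M_k\subsetneq F_k$ be a submodule such that $F_k/M_k$ has finite (nonzero) length. Put $F=F_1\oplus\cdots\oplus F_q$ and let $S(F)$ be the symmetric algebra of $F$ over $R$. For $n\ge 0$ let $S_n(F_k)$ and $S_n(M_k)$ denote the images in $S(F)$ of the $n$-th symmetric powers of $F_k$ and of $M_k$, under the maps induced by the inclusions $M_k\subseteq F_k\subseteq F$; products of such $R$-submodules are taken in $S(F)$. Write $\lambda$ for length of $R$-modules. Then $$f(n_1,\dots,n_q)=\lambda\left(\frac{S_{n_1}(F_1)\cdots S_{n_q}(F_q)}{S_{n_1}(M_1)\cdots S_{n_q}(M_q)}\right)$$ is finite for all $n_1,\dots,n_q\ge 0$, and there is a polynomial $p\in\mathbb Q[x_1,\dots,x_q]$ and an integer $N$ such that $f(n_1,\dots,n_q)=p(n_1,\dots,n_q)$ whenever $n_k\ge N$ for all $k$. The total degree of $p$ is $d+r_1+\cdots+r_q-q$. -/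

import Mathlib

namespace JointBR

/-- The `n`-th symmetric power `S_n(N)` of an `R`-module `N`: the degree `n` component of the
symmetric algebra `S(N)`, i.e. the `R`-span of all products of `n` elements of `N`. -/
noncomputable def symPower (R : Type*) [CommRing R] (N : Type*) [AddCommGroup N] [Module R N]
    (n : ℕ) : Submodule R (SymmetricAlgebra R N) :=
  (LinearMap.range (SymmetricAlgebra.ι R N)) ^ n

/-- The algebra map `S(N) → S(F)` induced by a linear map `N → F`. -/
noncomputable def symMap {R : Type*} [CommRing R] {N F : Type*} [AddCommGroup N] [Module R N]
    [AddCommGroup F] [Module R F] (f : N →ₗ[R] F) :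
    SymmetricAlgebra R N →ₐ[R] SymmetricAlgebra R F :=
  SymmetricAlgebra.lift (SymmetricAlgebra.ι R F ∘ₗ f)

/-- For a submodule `M` of `F k`, the image of the symmetric power `S_n(M)` in the symmetric
algebra of the direct sum `F 0 ⊕ ⋯ ⊕ F (q - 1)`, under the map induced by the inclusions
`M ⊆ F k ⊆ F 0 ⊕ ⋯ ⊕ F (q - 1)`. -/
noncomputable def symImage (R : Type*) [CommRing R] {q : ℕ} (F : Fin q → Type*)
    [∀ k, AddCommGroup (F k)] [∀ k, Module R (F k)] (k : Fin q) (M : Submodule R (F k)) (n : ℕ) :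
    Submodule R (SymmetricAlgebra R (∀ k, F k)) :=
  (symPower R M n).map (symMap (LinearMap.single R F k ∘ₗ M.subtype)).toLinearMap

/-- Inside the symmetric algebra of the direct sum, `S_n(M)` is the `n`-th power of `M`. -/
theorem symImage_eq_pow (R : Type*) [CommRing R] {q : ℕ} (F : Fin q → Type*)
    [∀ k, AddCommGroup (F k)] [∀ k, Module R (F k)] (k : Fin q) (M : Submodule R (F k)) (n : ℕ) :
    symImage R F k M n =
      (M.map (SymmetricAlgebra.ι R (∀ k, F k) ∘ₗ LinearMap.single R F k)) ^ n := by
  unfold symImage symPower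
  rw [Submodule.map_pow, ← LinearMap.range_comp]
  congr 1
  have h : (symMap (LinearMap.single R F k ∘ₗ M.subtype)).toLinearMap ∘ₗ SymmetricAlgebra.ι R M =
      (SymmetricAlgebra.ι R (∀ k, F k) ∘ₗ LinearMap.single R F k) ∘ₗ M.subtype := by
    ext x
    simp [symMap]
  rw [h, LinearMap.range_comp, Submodule.range_subtype]

/-- The product `S_{n 0}(M 0) ⋯ S_{n (q-1)}(M (q-1))` inside the symmetric algebra of
`F 0 ⊕ ⋯ ⊕ F (q - 1)`. -/
noncomputable def symProd (R : Type*) [CommRing R] {q : ℕ} (F : Fin q → Type*)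
    [∀ k, AddCommGroup (F k)] [∀ k, Module R (F k)] (M : ∀ k, Submodule R (F k))
    (n : Fin q → ℕ) : Submodule R (SymmetricAlgebra R (∀ k, F k)) :=
  ∏ k, symImage R F k (M k) (n k)

/-- The joint Buchsbaum-Rim function: the length of the `R`-module
`S_{n 0}(F 0) ⋯ S_{n (q-1)}(F (q-1)) / S_{n 0}(M 0) ⋯ S_{n (q-1)}(M (q-1))`, possibly infinite. -/
noncomputable def jointBRFunction (R : Type*) [CommRing R] {q : ℕ} (F : Fin q → Type*)
    [∀ k, AddCommGroup (F k)] [∀ k, Module R (F k)] (M : ∀ k, Submodule R (F k))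
    (n : Fin q → ℕ) : ℕ∞ :=
  Module.length R
    (symProd R F (fun _ => ⊤) n ⧸ (symProd R F M n).submoduleOf (symProd R F (fun _ => ⊤) n))

/-- The product of the `S_{n k}(M k)` is contained in the product of the `S_{n k}(F k)`, so the
quotient above is the literal one. -/
theorem symProd_le (R : Type*) [CommRing R] {q : ℕ} (F : Fin q → Type*)
    [∀ k, AddCommGroup (F k)] [∀ k, Module R (F k)] (M : ∀ k, Submodule R (F k))
    (n : Fin q → ℕ) : symProd R F M n ≤ symProd R F (fun _ => ⊤) n := by
  unfold symProd
  refine Finset.prod_le_prod' fun k _ => ?_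
  rw [symImage_eq_pow, symImage_eq_pow]
  exact pow_le_pow_left' (Submodule.map_mono le_top) _

end JointBR

/-! Write `M^n` and `F^n` for the products of the `M k ^ n k` and of the `F k ^ n k`, taken in a
commutative algebra `B` (here the symmetric algebra), and put `ρ k = r k - 1`.

Polynomiality. The quotients `F^n / M^n` form a graded module over the multi-Rees algebra of the `M
k`, but it need not be finitely generated. The remedy is an auxiliary variable. In `B[X]` the
product `S_n` of the `(M k + F k X) ^ n k` is graded by the degree in `X`, and its coefficient
modules increase from `M^n` in degree `0` to `F^n` in degree `∑ n k`. The length of `F^n / M^n` is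
the sum of the lengths of the successive quotients, which is the length of the elements of `S_n`
without constant term modulo `S_n ∩ X S_n` (`IsGraded.relLength_shiftPart`). These are the graded
pieces of a subquotient of the multi-Rees algebra of the `M k + F k X`, which is Noetherian. An
induction on generators in each direction gives eventual vanishing of iterated differences
(`exists_fwdDiff_hilbertFunction_eq_zero_aux`), and Newton's formula then gives a polynomial.

Degree, upper bound. `F^n` has at most `∏ (n k + 1) ^ ρ k` generators, and a power of the maximal
ideal linear in `∑ n k` kills `F^n / M^n`; so the growth is at most `∑ ρ k + d`
(`relLength_multiPow_le`, `exists_length_pow_le`).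

Degree, lower bound. Each `M k` lies in `𝔪 e₀ ⊕ R e₁ ⊕ ⋯` for a suitable basis. So in `S(F)`, a
polynomial ring, the coefficient of a monomial in an element of `M^n` lies in the power of `𝔪` given
by the exponents of the variables `e₀`. Counting monomials with large such exponent yields about `c
^ ∑ ρ k` copies of `R / 𝔪 ^ c` (`le_relLength_multiPow`), each of length of order `c ^ d`
(`exists_pow_le_length`). Growth along rays determines the total degree
(`totalDegree_eq_of_growth`). -/

namespace JointBR

/-! ### Lengths of subquotients -/

section RelativeLength

variable {R V V' : Type*} [CommRing R] [AddCommGroup V] [Module R V] [AddCommGroup V'] [Module R V']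

/-- The length of `U / (U ∩ W)`. -/
noncomputable def relLength (W U : Submodule R V) : ℕ∞ :=
  Module.length R (U ⧸ W.submoduleOf U)

lemma relLength_eq_of_surjective (W U : Submodule R V) (g : U →ₗ[R] V')
    (hg : Function.Surjective g) (hk : LinearMap.ker g = W.submoduleOf U) :
    relLength W U = Module.length R V' := by
  unfold relLength
  rw [← hk]
  exact (g.quotKerEquivOfSurjective hg).length_eq

lemma relLength_eq_length_map (W U : Submodule R V) :
    relLength W U = Module.length R (U.map W.mkQ) := by
  refine relLength_eq_of_surjective W U (W.mkQ.submoduleMap U) (W.mkQ.submoduleMap_surjective U) ?_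
  ext x
  simp [Submodule.submoduleOf, Subtype.ext_iff]

lemma relLength_top (W : Submodule R V) : relLength W ⊤ = Module.length R (V ⧸ W) := by
  rw [relLength_eq_length_map, Submodule.map_top, Submodule.range_mkQ, Module.length_top]

lemma relLength_comap (f : V →ₗ[R] V') (W : Submodule R V') (U : Submodule R V) :
    relLength (W.comap f) U = relLength W (U.map f) := by
  rw [relLength_eq_length_map W, ← Submodule.map_comp]
  refine relLength_eq_of_surjective _ _ ((W.mkQ ∘ₗ f).submoduleMap U)
    ((W.mkQ ∘ₗ f).submoduleMap_surjective U) ?_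
  ext x
  simp [Submodule.submoduleOf, Subtype.ext_iff]

lemma relLength_inf_left (W U : Submodule R V) : relLength (U ⊓ W) U = relLength W U := by
  unfold relLength
  congr 2 <;> simp [Submodule.submoduleOf]

lemma relLength_sup_right (W U : Submodule R V) : relLength W (U ⊔ W) = relLength W U := by
  rw [relLength_eq_length_map, relLength_eq_length_map, Submodule.map_sup, Submodule.mkQ_map_self,
    sup_bot_eq]

lemma relLength_mono_right (W : Submodule R V) {U U' : Submodule R V} (h : U ≤ U') :
    relLength W U ≤ relLength W U' := by
  rw [relLength_eq_length_map, relLength_eq_length_map]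
  exact Module.length_le_of_injective _ (Submodule.inclusion_injective (Submodule.map_mono h))

lemma relLength_anti_left {W W' : Submodule R V} (U : Submodule R V) (h : W ≤ W') :
    relLength W' U ≤ relLength W U :=
  Module.length_le_of_surjective (Submodule.factor (Submodule.comap_mono h))
    (Submodule.factor_surjective _)

lemma relLength_eq_zero_iff {W U : Submodule R V} : relLength W U = 0 ↔ U ≤ W := by
  rw [relLength_eq_length_map, Module.length_eq_zero_iff, Submodule.subsingleton_iff_eq_bot,
    ← le_bot_iff, Submodule.map_le_iff_le_comap, Submodule.comap_bot, Submodule.ker_mkQ]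

lemma relLength_add {W₁ W₂ U : Submodule R V} (h₁ : W₁ ≤ W₂) (h₂ : W₂ ≤ U) :
    relLength W₁ U = relLength W₁ W₂ + relLength W₂ U := by
  have h : relLength W₁ W₂ =
      Module.length R ((W₂.submoduleOf U).map (W₁.submoduleOf U).mkQ) := by
    rw [← relLength_eq_length_map, Submodule.submoduleOf, Submodule.submoduleOf, relLength_comap,
      Submodule.map_comap_subtype, inf_eq_right.2 h₂]
  rw [h]
  unfold relLength
  rw [Module.length_eq_add_of_exact (((W₂.submoduleOf U).map (W₁.submoduleOf U).mkQ).subtype)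
    (((W₂.submoduleOf U).map (W₁.submoduleOf U).mkQ).mkQ) (Submodule.subtype_injective _)
    (Submodule.mkQ_surjective _) (LinearMap.exact_subtype_mkQ _)]
  congr 1
  exact (Submodule.quotientQuotientEquivQuotient _ _ (Submodule.comap_mono h₁)).length_eq

/-- Multiplying a subquotient into another one: kernel and cokernel have complementary lengths. -/
lemma relLength_add_of_map (f : V →ₗ[R] V') {W U : Submodule R V} {W' U' : Submodule R V'}
    (hWU : W ≤ U) (hW : W ≤ W'.comap f) (hU : U.map f ≤ U') (hW' : W' ≤ U') :
    relLength W U + relLength (U.map f ⊔ W') U' =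
      relLength W (U ⊓ W'.comap f) + relLength W' U' := by
  rw [relLength_add (le_inf hWU hW) inf_le_left, relLength_inf_left, relLength_comap,
    relLength_add (le_sup_right : W' ≤ U.map f ⊔ W') (sup_le hU hW'), relLength_sup_right,
    add_assoc]

end RelativeLength

/-! ### Iterated differences and polynomial functions -/

section ForwardDifference

open Function fwdDiff

variable {σ : Type*}

lemma fwdDiff_comm {A G : Type*} [AddCommMonoid A] [AddCommGroup G] (a b : A) :
    Function.Commute (fwdDiff (G := G) a) (fwdDiff b) := by
  intro f
  ext x
  simp only [fwdDiff, add_right_comm x a b]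
  abel

lemma fwdDiff_iter_eq_of_dependsOn (h : (σ → ℕ) → ℚ) (S : Set σ)
    (hS : ∀ n n' : σ → ℕ, (∀ k ∈ S, n k = n' k) → h n = h n') (e : σ → ℕ) (i : ℕ)
    (n n' : σ → ℕ) (hn : ∀ k ∈ S, n k = n' k) : (fwdDiff e)^[i] h n = (fwdDiff e)^[i] h n' := by
  rw [fwdDiff_iter_eq_sum_shift, fwdDiff_iter_eq_sum_shift]
  refine Finset.sum_congr rfl fun j _ => ?_
  rw [hS (n + j • e) (n' + j • e) fun k hk => by simp [hn k hk]]

variable [DecidableEq σ]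

lemma fwdDiff_iter_comp_update (h : (σ → ℕ) → ℚ) {j k : σ} (hjk : j ≠ k) (i : ℕ) (n : σ → ℕ) :
    (fwdDiff (Pi.single j 1))^[i] (fun m => h (update m k 0)) n =
      (fwdDiff (Pi.single j 1))^[i] h (update n k 0) := by
  rw [fwdDiff_iter_eq_sum_shift, fwdDiff_iter_eq_sum_shift]
  refine Finset.sum_congr rfl fun a _ => ?_
  congr 2
  ext l
  by_cases hl : l = k
  · subst hl
    simp [hjk.symm]
  · simp [hl]

lemma exists_polynomial_eval_eq_choose (i : ℕ) :
    ∃ P : Polynomial ℚ, ∀ n : ℕ, P.eval (n : ℚ) = (n.choose i : ℚ) := by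
  refine ⟨Polynomial.C ((i.factorial : ℚ)⁻¹) * descPochhammer ℚ i, fun n => ?_⟩
  rw [Polynomial.eval_mul, Polynomial.eval_C, Nat.cast_choose_eq_descPochhammer_div]
  field_simp

/-- Newton's expansion in the variable `k`, cut off where the differences vanish. -/
lemma eq_sum_choose_mul_fwdDiff (h : (σ → ℕ) → ℚ) (k : σ) (t : ℕ)
    (ht : (fwdDiff (Pi.single k 1))^[t] h = 0) (n : σ → ℕ) :
    h n = ∑ i ∈ Finset.range t,
      ((n k).choose i : ℚ) * (fwdDiff (Pi.single k 1))^[i] h (update n k 0) := by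
  have hn : n = update n k 0 + n k • Pi.single k 1 := by
    ext l
    by_cases hl : l = k
    · subst hl; simp
    · simp [hl]
  conv_lhs => rw [hn, shift_eq_sum_fwdDiff_iter (Pi.single k 1) h (n k) (update n k 0)]
  simp only [nsmul_eq_mul]
  have hz : ∀ i, t ≤ i → (fwdDiff (Pi.single k 1))^[i] h = 0 := by
    intro i hi
    obtain ⟨j, rfl⟩ := Nat.exists_eq_add_of_le' hi
    rw [iterate_add_apply, ht]
    exact iterate_fixed (by ext; simp [fwdDiff]) j
  -- Both sums are extended to a common range: beyond `n k` the binomials vanish, beyond `t` the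
  -- differences do.
  refine (Finset.sum_subset (Finset.range_mono (le_max_right t (n k + 1))) ?_).trans
    (Finset.sum_subset (Finset.range_mono (le_max_left t (n k + 1))) ?_).symm
  · intro i _ hi
    rw [Nat.choose_eq_zero_of_lt (by simpa using hi)]
    simp
  · intro i _ hi
    rw [hz i (by simpa using hi)]
    simp

/-- Newton's expansion in one variable has coefficients that depend only on the remaining ones;
since differences in distinct directions commute, these coefficients inherit the hypothesis. -/
lemma exists_mvPolynomial_of_dependsOn (t : ℕ) (S : Finset σ) : ∀ h : (σ → ℕ) → ℚ,
    (∀ k ∈ S, (fwdDiff (Pi.single k 1))^[t] h = 0) →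
    (∀ n n' : σ → ℕ, (∀ k ∈ S, n k = n' k) → h n = h n') →
    ∃ p : MvPolynomial σ ℚ, ∀ n : σ → ℕ, h n = MvPolynomial.eval (fun k => (n k : ℚ)) p := by
  induction S using Finset.induction_on with
  | empty =>
    intro h _ hd
    exact ⟨MvPolynomial.C (h 0), fun n => by rw [MvPolynomial.eval_C]; exact hd _ _ (by simp)⟩
  | insert k S hk ih =>
    intro h ht hd
    have key : ∀ i, ∃ p : MvPolynomial σ ℚ, ∀ n : σ → ℕ,
        (fwdDiff (Pi.single k 1))^[i] h (update n k 0) =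
          MvPolynomial.eval (fun k => (n k : ℚ)) p := by
      intro i
      refine ih (fun n => (fwdDiff (Pi.single k 1))^[i] h (update n k 0)) ?_ ?_
      · intro j hj
        have hjk : j ≠ k := fun e => hk (e ▸ hj)
        ext n
        rw [fwdDiff_iter_comp_update _ hjk,
          ((fwdDiff_comm (Pi.single j 1) (Pi.single k 1)).iterate_iterate t i) h,
          ht j (Finset.mem_insert_of_mem hj), iterate_fixed (by ext; simp [fwdDiff]) i]
        rfl
      · intro n n' hn
        refine fwdDiff_iter_eq_of_dependsOn h (insert k S : Finset σ) (fun a b hab => hd a b hab)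
          _ _ _ _ ?_
        intro l hl
        by_cases hlk : l = k
        · subst hlk; simp
        · simpa [hlk] using hn l ((Finset.mem_insert.1 hl).resolve_left hlk)
    choose p hp using key
    choose P hP using exists_polynomial_eval_eq_choose
    refine ⟨∑ i ∈ Finset.range t, Polynomial.aeval (MvPolynomial.X k) (P i) * p i, fun n => ?_⟩
    rw [eq_sum_choose_mul_fwdDiff h k t (ht k (Finset.mem_insert_self _ _)), map_sum]
    refine Finset.sum_congr rfl fun i _ => ?_
    rw [map_mul, hp, ← hP]
    congr 1
    rw [Polynomial.aeval_def, Polynomial.hom_eval₂, MvPolynomial.eval_X, ← Polynomial.eval₂_id]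
    congr 1
    exact Subsingleton.elim _ _

/-- A function on `ℕ^σ` some iterated difference of which vanishes eventually in every
coordinate direction is eventually a polynomial. -/
theorem exists_mvPolynomial_of_fwdDiff [Fintype σ] (h : (σ → ℕ) → ℚ)
    (H : ∀ k, ∃ t N : ℕ, ∀ n : σ → ℕ, N ≤ n k → (fwdDiff (Pi.single k 1))^[t] h n = 0) :
    ∃ p : MvPolynomial σ ℚ, ∃ N : ℕ, ∀ n : σ → ℕ, (∀ k, N ≤ n k) →
      h n = MvPolynomial.eval (fun k => (n k : ℚ)) p := by
  choose t N H using H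
  let t₀ := Finset.univ.sup t
  let N₀ := Finset.univ.sup N
  let c : σ → ℕ := fun _ => N₀
  -- After translation by `N₀` in every direction the differences vanish everywhere, not just
  -- eventually.
  obtain ⟨p, hp⟩ := exists_mvPolynomial_of_dependsOn t₀ Finset.univ (fun n => h (n + c)) (by
    intro k _
    obtain ⟨j, hj⟩ := Nat.exists_eq_add_of_le' (Finset.le_sup (f := t) (Finset.mem_univ k))
    have hz : (fwdDiff (Pi.single k 1))^[t k] (fun n => h (n + c)) = 0 := by
      ext n
      rw [fwdDiff_iter_comp_add]
      exact H k _ (le_add_left (Finset.le_sup (f := N) (Finset.mem_univ k)))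
    change (fwdDiff (Pi.single k 1))^[Finset.univ.sup t] _ = 0
    rw [hj, iterate_add_apply, hz]
    exact iterate_fixed (by ext; simp [fwdDiff]) j) (fun n n' hn => by
      rw [funext fun k => hn k (Finset.mem_univ k)])
  refine ⟨MvPolynomial.aeval (fun k => MvPolynomial.X k - MvPolynomial.C (N₀ : ℚ)) p, N₀,
    fun n hn => ?_⟩
  have hn' : n = (n - c) + c := by
    ext k
    simp [c, hn k]
  conv_lhs => rw [hn']
  rw [hp, MvPolynomial.aeval_def, MvPolynomial.eval₂_comp_left, MvPolynomial.eval,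
    MvPolynomial.coe_eval₂Hom]
  congr 1
  · exact Subsingleton.elim _ _
  · ext k
    simp [c, Nat.cast_sub (hn k)]

end ForwardDifference

/-! ### Noetherianity of the multi-Rees algebra -/

section MultiRees

variable {R C σ : Type*} [CommRing R] [CommRing C] [Algebra R C] [Fintype σ]

/-- The product of powers `∏ k, L k ^ n k` of a family of submodules of an algebra. -/
def multiPow (L : σ → Submodule R C) (n : σ → ℕ) : Submodule R C := ∏ k, L k ^ n k

lemma multiPow_zero (L : σ → Submodule R C) : multiPow L 0 = 1 := by simp [multiPow]

lemma multiPow_add (L : σ → Submodule R C) (m n : σ → ℕ) :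
    multiPow L (m + n) = multiPow L m * multiPow L n := by
  simp [multiPow, pow_add, Finset.prod_mul_distrib]

variable [DecidableEq σ]

lemma multiPow_single (L : σ → Submodule R C) (k : σ) :
    multiPow L (Pi.single k 1) = L k := by
  unfold multiPow
  rw [Finset.prod_eq_single k (fun l _ hl => by simp [hl]) (by simp)]
  simp

lemma exponent_induction {P : (σ → ℕ) → Prop} (h0 : P 0)
    (hadd : ∀ m n, P m → P n → P (m + n)) (hsingle : ∀ k, P (Pi.single k 1)) (n : σ → ℕ) : P n := by
  let A : AddSubmonoid (σ → ℕ) :=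
    { carrier := {m | P m}, zero_mem' := h0, add_mem' := fun {a b} ha hb => hadd a b ha hb }
  change n ∈ A
  rw [← Finset.univ_sum_single n]
  refine sum_mem fun k _ => ?_
  have hk : (Pi.single k (n k) : σ → ℕ) = n k • Pi.single k 1 := by
    rw [← Pi.single_smul]
    simp
  rw [hk]
  exact nsmul_mem (hsingle k) _

/-- A family of submodules indexed by exponents, stable under multiplication by the `L k`. -/
def IsStable (L : σ → Submodule R C) (T : (σ → ℕ) → Submodule R C) : Prop :=
  ∀ k n, ∀ y ∈ L k, ∀ u ∈ T n, y * u ∈ T (n + Pi.single k 1)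

lemma IsStable.multiPow_mul_le {L : σ → Submodule R C} {T : (σ → ℕ) → Submodule R C}
    (hT : IsStable L T) (m : σ → ℕ) : ∀ n, multiPow L m * T n ≤ T (n + m) := by
  induction m using exponent_induction with
  | h0 => intro n; rw [multiPow_zero, one_mul, add_zero]
  | hadd a b ha hb =>
    intro n
    rw [multiPow_add, mul_comm (multiPow L a), mul_assoc, ← add_assoc]
    exact (mul_le_mul_right (ha n) _).trans (hb _)
  | hsingle k =>
    intro n
    rw [multiPow_single, Submodule.mul_le]
    exact hT k n

/-- The multi-Rees algebra of finite sets `G k` of elements of an algebra. -/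
noncomputable def multiRees (R : Type*) [CommRing R] [Algebra R C] (G : σ → Finset C) :
    Subalgebra R (MvPolynomial σ C) :=
  Algebra.adjoin R (⋃ k, (MvPolynomial.monomial (Finsupp.single k 1) : C → _) '' (G k : Set C))

omit [DecidableEq σ] in
lemma multiRees_isNoetherianRing [IsNoetherianRing R] (G : σ → Finset C) :
    IsNoetherianRing (multiRees R G) := by
  have hfin : (⋃ k, (MvPolynomial.monomial (Finsupp.single k 1) : C → MvPolynomial σ C) ''
      (G k : Set C)).Finite := Set.finite_iUnion fun k => (G k).finite_toSet.image _
  have : Algebra.FiniteType R (multiRees R G) := by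
    rw [← Subalgebra.fg_iff_finiteType, multiRees, ← hfin.coe_toFinset]
    exact Subalgebra.fg_adjoin_finset _
  exact Algebra.FiniteType.isNoetherianRing R _

variable {L : σ → Submodule R C} {G : σ → Finset C}

lemma coeff_mem_of_mem_multiRees (hG : ∀ k, Submodule.span R (G k : Set C) = L k)
    {b : MvPolynomial σ C} (hb : b ∈ multiRees R G) :
    ∀ m : σ →₀ ℕ, b.coeff m ∈ multiPow L m := by
  induction hb using Algebra.adjoin_induction with
  | mem x hx =>
    intro m
    obtain ⟨k, c, hc, rfl⟩ := Set.mem_iUnion.1 hx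
    rw [MvPolynomial.coeff_monomial]
    split_ifs with h
    · rw [← h, Finsupp.single_eq_pi_single, multiPow_single, ← hG]
      exact Submodule.subset_span hc
    · exact zero_mem _
  | algebraMap r =>
    intro m
    rw [MvPolynomial.algebraMap_apply, MvPolynomial.coeff_C]
    split_ifs with h
    · rw [← h, Finsupp.coe_zero, multiPow_zero]
      exact Submodule.mem_one.2 ⟨r, rfl⟩
    · exact zero_mem _
  | add x y _ _ hx hy =>
    intro m
    rw [MvPolynomial.coeff_add]
    exact add_mem (hx m) (hy m)
  | mul x y _ _ hx hy =>
    intro m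
    rw [MvPolynomial.coeff_mul]
    refine sum_mem fun a ha => ?_
    rw [← Finset.HasAntidiagonal.mem_antidiagonal.1 ha, Finsupp.coe_add, multiPow_add]
    exact Submodule.mul_mem_mul (hx _) (hy _)

lemma monomial_mem_multiRees (hG : ∀ k, Submodule.span R (G k : Set C) = L k) (m : σ → ℕ) :
    ∀ c ∈ multiPow L m,
      MvPolynomial.monomial (Finsupp.equivFunOnFinite.symm m) c ∈ multiRees R G := by
  induction m using exponent_induction with
  | h0 =>
    intro c hc
    rw [multiPow_zero] at hc
    obtain ⟨r, rfl⟩ := Submodule.mem_one.1 hc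
    have : (Finsupp.equivFunOnFinite.symm 0 : σ →₀ ℕ) = 0 := by ext; simp
    rw [this]
    exact (multiRees R G).algebraMap_mem r
  | hadd a b ha hb =>
    intro c hc
    have hab : (Finsupp.equivFunOnFinite.symm (a + b) : σ →₀ ℕ) =
      Finsupp.equivFunOnFinite.symm a + Finsupp.equivFunOnFinite.symm b := by ext; simp
    rw [multiPow_add] at hc
    rw [hab]
    induction hc using Submodule.mul_induction_on' with
    | mem_mul_mem x hx y hy =>
      rw [← MvPolynomial.monomial_mul]
      exact mul_mem (ha x hx) (hb y hy)
    | add x _ y _ hx hy =>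
      rw [map_add]
      exact add_mem hx hy
  | hsingle k =>
    intro c hc
    have hk : (Finsupp.equivFunOnFinite.symm (Pi.single k 1) : σ →₀ ℕ) = Finsupp.single k 1 := by
      ext; simp [Finsupp.single_eq_pi_single]
    rw [multiPow_single, ← hG] at hc
    rw [hk]
    induction hc using Submodule.span_induction with
    | mem x hx =>
      exact Algebra.subset_adjoin (Set.mem_iUnion.2 ⟨k, x, hx, rfl⟩)
    | zero => rw [map_zero]; exact zero_mem _
    | add x y _ _ hx hy => rw [map_add]; exact add_mem hx hy
    | smul r x _ hx => rw [← MvPolynomial.smul_monomial]; exact (multiRees R G).smul_mem hx r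

/-- The ideal of the multi-Rees algebra attached to a stable family. -/
def stableIdeal (hG : ∀ k, Submodule.span R (G k : Set C) = L k)
    {T : (σ → ℕ) → Submodule R C} (hT : IsStable L T) : Ideal (multiRees R G) where
  carrier := {b | ∀ m : σ →₀ ℕ, b.1.coeff m ∈ T m}
  zero_mem' := fun m => by simp
  add_mem' := fun {a b} ha hb m => by
    rw [Subalgebra.coe_add, MvPolynomial.coeff_add]
    exact add_mem (ha m) (hb m)
  smul_mem' := fun c b hb m => by
    rw [smul_eq_mul, Subalgebra.coe_mul, MvPolynomial.coeff_mul]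
    refine sum_mem fun a ha => ?_
    rw [← Finset.HasAntidiagonal.mem_antidiagonal.1 ha, add_comm, Finsupp.coe_add]
    exact hT.multiPow_mul_le _ _
      (Submodule.mul_mem_mul (coeff_mem_of_mem_multiRees hG c.2 _) (hb _))

/-- Ascending chains of stable subfamilies of the powers of finitely generated modules stop. -/
lemma exists_stable_chain_eq [IsNoetherianRing R] (hL : ∀ k, (L k).FG)
    (T : ℕ → (σ → ℕ) → Submodule R C) (hT : ∀ i, IsStable L (T i)) (hmono : Monotone T)
    (hle : ∀ i, T i ≤ multiPow L) : ∃ N, ∀ i, N ≤ i → T i = T N := by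
  choose G hG using hL
  have := multiRees_isNoetherianRing (R := R) G
  let J : ℕ →o Ideal (multiRees R G) :=
    ⟨fun i => stableIdeal hG (hT i), fun i j hij b hb m => hmono hij _ (hb m)⟩
  obtain ⟨N, hN⟩ := monotone_stabilizes_iff_noetherian.2 this J
  refine ⟨N, fun i hi => le_antisymm (fun m c hc => ?_) (hmono hi)⟩
  -- The ideal determines the family: an element of degree `m` is tested through its monomial.
  have hmem : (⟨_, monomial_mem_multiRees hG m c (hle i m hc)⟩ : multiRees R G) ∈ J i := by
    intro l
    rw [MvPolynomial.coeff_monomial]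
    split_ifs with h
    · rw [← h]; exact hc
    · exact zero_mem _
  rw [← hN i hi] at hmem
  simpa using hmem (Finsupp.equivFunOnFinite.symm m)

end MultiRees

/-! ### Hilbert functions of multigraded subquotients -/

section HilbertFunction

open fwdDiff

variable {R C σ : Type*} [CommRing R] [CommRing C] [Algebra R C] [Fintype σ] [DecidableEq σ]
  [IsNoetherianRing R]

/-- The length of the degree `n` piece of the graded module `U / W`. -/
noncomputable def hilbertFunction (W U : (σ → ℕ) → Submodule R C) (n : σ → ℕ) : ℚ :=
  ((relLength (W n) (U n)).toNat : ℚ)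

/-- If `L k` kills `U / W`, the family equal to `U` where `n k ≤ j` and to `W` beyond is stable:
only `L k` crosses the threshold, and it lands in `W`. These families ascend with `j`, so they stop,
which forces `U = W` for large `n k`. -/
lemma exists_eq_of_mul_le {L : σ → Submodule R C} (hL : ∀ k, (L k).FG) (k : σ)
    {W U : (σ → ℕ) → Submodule R C} (hW : IsStable L W) (hU : IsStable L U) (hWU : W ≤ U)
    (hUL : U ≤ multiPow L)
    (hk : ∀ n, ∀ y ∈ L k, ∀ u ∈ U n, y * u ∈ W (n + Pi.single k 1)) :
    ∃ N, ∀ n : σ → ℕ, N ≤ n k → U n = W n := by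
  classical
  obtain ⟨N, hN⟩ := exists_stable_chain_eq hL (fun j n => if n k ≤ j then U n else W n)
    (fun j l n y hy u hu => by
      dsimp only at hu ⊢
      split_ifs at hu with h1
      · split_ifs with h2
        · exact hU l n y hy u hu
        · have hl : l = k := by
            by_contra hl
            exact h2 (by simpa [hl, Ne.symm hl] using h1)
          subst hl
          exact hk n y hy u hu
      · have h2 : ¬ (n + Pi.single l 1 : σ → ℕ) k ≤ j := fun h => h1 (le_trans (by simp) h)
        rw [if_neg h2]
        exact hW l n y hy u hu)
    (fun i j hij n => by
      dsimp only
      split_ifs with h1 h2 h2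
      · exact le_rfl
      · exact absurd (h1.trans hij) h2
      · exact hWU n
      · exact le_rfl)
    (fun i n => by
      dsimp only
      split_ifs
      · exact hUL n
      · exact (hWU n).trans (hUL n))
  refine ⟨N + 1, fun n hn => ?_⟩
  have := congrFun (hN (n k) (by omega)) n
  rwa [if_pos le_rfl, if_neg (by omega)] at this

/-- `S` contains the generators of `L k` that may act nontrivially on `U / W`. Multiplication by `x
∈ S` has kernel `K / W` and cokernel `U / Q`, both killed by `x`, so both are covered by a smaller
`S`. The exact sequence makes the difference of the Hilbert function a combination of theirs. -/
lemma exists_fwdDiff_hilbertFunction_eq_zero_aux {L : σ → Submodule R C} (hL : ∀ k, (L k).FG)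
    (k : σ) (G : Finset C) (hG : Submodule.span R (G : Set C) = L k) (S : Finset C) :
    ∀ W U : (σ → ℕ) → Submodule R C, IsStable L W → IsStable L U → W ≤ U → U ≤ multiPow L →
    (∀ n, relLength (W n) (U n) ≠ ⊤) →
    (∀ x ∈ G, x ∉ S → ∀ n, ∀ u ∈ U n, x * u ∈ W (n + Pi.single k 1)) → S ⊆ G →
    ∃ N, ∀ n : σ → ℕ, N ≤ n k → (fwdDiff (Pi.single k 1))^[S.card] (hilbertFunction W U) n = 0 := by
  classical
  induction S using Finset.induction_on with
  | empty =>
    intro W U hW hU hWU hUL _ hkill _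
    obtain ⟨N, hN⟩ := exists_eq_of_mul_le hL k hW hU hWU hUL (by
      intro n y hy u hu
      rw [← hG] at hy
      induction hy using Submodule.span_induction with
      | mem x hx => exact hkill x hx (by simp) n u hu
      | zero => rw [zero_mul]; exact zero_mem _
      | add x y _ _ hx hy => rw [add_mul]; exact add_mem hx hy
      | smul r x _ hx => rw [smul_mul_assoc]; exact Submodule.smul_mem _ r hx)
    refine ⟨N, fun n hn => ?_⟩
    simp [hilbertFunction, relLength_eq_zero_iff.2 (hN n hn).le]
  | insert x S hx ih =>
    intro W U hW hU hWU hUL hfin hkill hSG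
    set e : σ → ℕ := Pi.single k 1 with he
    have hxL : x ∈ L k := hG ▸ Submodule.subset_span (hSG (Finset.mem_insert_self x S))
    let K : (σ → ℕ) → Submodule R C := fun n => U n ⊓ (W (n + e)).comap (LinearMap.mulLeft R x)
    -- The supremum over `m + e = n` stands for `x * U (n - e)`; it is empty when `n k = 0`, where
    -- truncated subtraction would be wrong.
    let Q : (σ → ℕ) → Submodule R C := fun n =>
      W n ⊔ ⨆ m, ⨆ _ : m + e = n, (U m).map (LinearMap.mulLeft R x)
    have hWK : W ≤ K := fun n => le_inf (hWU n) fun u hu => hW k n x hxL u hu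
    have hKU : K ≤ U := fun n => inf_le_left
    have hWQ : W ≤ Q := fun n => le_sup_left
    have hmap : ∀ n, (U n).map (LinearMap.mulLeft R x) ≤ U (n + e) := fun n => by
      rw [Submodule.map_le_iff_le_comap]
      exact fun u hu => hU k n x hxL u hu
    have hQU : Q ≤ U := fun n => sup_le (hWU n) <| iSup_le fun m => iSup_le fun h => h ▸ hmap m
    have hQe : ∀ n, Q (n + e) = (U n).map (LinearMap.mulLeft R x) ⊔ W (n + e) := fun n => by
      change W (n + e) ⊔ _ = _
      rw [sup_comm]
      congr 1
      refine le_antisymm (iSup_le fun m => iSup_le fun h => ?_)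
        (le_iSup_of_le n (le_iSup_of_le rfl le_rfl))
      rw [add_right_cancel h]
    have hK : IsStable L K := fun l n y hy u hu => by
      refine ⟨hU l n y hy u hu.1, ?_⟩
      have := hW l _ y hy _ hu.2
      rw [add_right_comm] at this
      simpa [mul_left_comm] using this
    have hQ : IsStable L Q := fun l n y hy u hu => by
      have hle : Q n ≤ (Q (n + Pi.single l 1)).comap (LinearMap.mulLeft R y) := by
        refine sup_le (fun w hw => hWQ _ (hW l n y hy w hw)) (iSup_le fun m => iSup_le fun h => ?_)
        subst h
        rw [Submodule.map_le_iff_le_comap]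
        intro u hu
        rw [add_right_comm, hQe]
        refine Submodule.mem_sup_left ⟨y * u, hU l m y hy u hu, ?_⟩
        simp [mul_left_comm]
      exact hle hu
    obtain ⟨N₁, hN₁⟩ := ih W K hW hK hWK (hKU.trans hUL)
      (fun n => ne_top_of_le_ne_top (hfin n) (relLength_mono_right _ (hKU n)))
      (fun y hy hyS n u hu => by
        by_cases hyx : y = x
        · subst hyx; exact hu.2
        · exact hkill y hy (by simp [hyx, hyS]) n u hu.1)
      (fun y hy => hSG (Finset.mem_insert_of_mem hy))
    obtain ⟨N₂, hN₂⟩ := ih Q U hQ hU hQU hUL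
      (fun n => ne_top_of_le_ne_top (hfin n) (relLength_anti_left _ (hWQ n)))
      (fun y hy hyS n u hu => by
        by_cases hyx : y = x
        · subst hyx
          rw [hQe]
          exact Submodule.mem_sup_left ⟨u, hu, rfl⟩
        · exact hWQ _ (hkill y hy (by simp [hyx, hyS]) n u hu))
      (fun y hy => hSG (Finset.mem_insert_of_mem hy))
    have hrec : (fun n => hilbertFunction Q U (n + e)) =
        fwdDiff e (hilbertFunction W U) + hilbertFunction W K := by
      ext n
      have h := relLength_add_of_map (LinearMap.mulLeft R x) (hWU n) (fun u hu => hW k n x hxL u hu)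
        (hmap n) (hWU (n + e))
      rw [← hQe] at h
      have h1 := hfin n
      have h2 := ne_top_of_le_ne_top (hfin (n + e)) (relLength_anti_left _ (hWQ (n + e)))
      have h3 := ne_top_of_le_ne_top (hfin n) (relLength_mono_right _ (hKU n))
      have h4 := hfin (n + e)
      have h' := congrArg ENat.toNat h
      rw [ENat.toNat_add h1 h2, ENat.toNat_add h3 h4] at h'
      have h'' : (_ : ℚ) = _ := congrArg Nat.cast h'
      push_cast at h''
      simp only [hilbertFunction, fwdDiff, Pi.add_apply]
      change _ = _ +
        ((relLength (W n) (U n ⊓ (W (n + e)).comap (LinearMap.mulLeft R x))).toNat : ℚ)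
      linarith
    refine ⟨max N₁ N₂, fun n hn => ?_⟩
    have h := congrFun (congrArg (fwdDiff e)^[S.card] hrec) n
    rw [fwdDiff_iter_comp_add, fwdDiff_iter_add, Pi.add_apply, hN₁ n (le_of_max_le_left hn),
      hN₂ (n + e) (le_trans (le_of_max_le_right hn) (by simp)), add_zero] at h
    rw [Finset.card_insert_of_notMem hx, Function.iterate_succ_apply]
    exact h.symm

/-- The Hilbert function of a subquotient of a finitely generated multigraded algebra is eventually
polynomial. -/
theorem exists_mvPolynomial_eq_hilbertFunction {L : σ → Submodule R C} (hL : ∀ k, (L k).FG)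
    {W U : (σ → ℕ) → Submodule R C} (hW : IsStable L W) (hU : IsStable L U) (hWU : W ≤ U)
    (hUL : U ≤ multiPow L) (hfin : ∀ n, relLength (W n) (U n) ≠ ⊤) :
    ∃ p : MvPolynomial σ ℚ, ∃ N : ℕ, ∀ n : σ → ℕ, (∀ k, N ≤ n k) →
      hilbertFunction W U n = MvPolynomial.eval (fun k => (n k : ℚ)) p := by
  refine exists_mvPolynomial_of_fwdDiff _ fun k => ?_
  obtain ⟨G, hG⟩ := hL k
  obtain ⟨N, hN⟩ := exists_fwdDiff_hilbertFunction_eq_zero_aux hL k G hG G W U hW hU hWU hUL hfin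
    (fun x hx hx' => absurd hx hx') subset_rfl
  exact ⟨_, N, hN⟩

end HilbertFunction

/-! ### Counting generators of powers -/

section Generators

open scoped Pointwise

variable {R V C : Type*} [CommRing R] [AddCommGroup V] [Module R V] [CommRing C] [Algebra R C]

lemma relLength_sup_le (W U₁ U₂ : Submodule R V) :
    relLength W (U₁ ⊔ U₂) ≤ relLength W U₁ + relLength W U₂ := by
  rw [← relLength_sup_right W (U₁ ⊔ U₂),
    relLength_add (le_sup_right : W ≤ U₁ ⊔ W) (sup_le_sup_right le_sup_left W),
    relLength_sup_right]
  have h : U₁ ⊔ U₂ ⊔ W = U₂ ⊔ (U₁ ⊔ W) := by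
    rw [← sup_assoc, sup_comm U₂]
  rw [h, relLength_sup_right]
  gcongr
  exact relLength_anti_left _ le_sup_right

/-- Modulo `W`, each generator spans a quotient of `R ⧸ I`. -/
lemma relLength_span_le (W : Submodule R V) (I : Ideal R) (t : Finset V)
    (ht : ∀ x ∈ t, ∀ a ∈ I, a • x ∈ W) :
    relLength W (Submodule.span R (t : Set V)) ≤ t.card * Module.length R (R ⧸ I) := by
  classical
  induction t using Finset.induction_on with
  | empty => simp [relLength_eq_zero_iff.2 (bot_le : ⊥ ≤ W)]
  | insert x t hx ih =>
    rw [Finset.coe_insert, Submodule.span_insert, Finset.card_insert_of_notMem hx]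
    refine (relLength_sup_le _ _ _).trans ?_
    push_cast
    rw [add_mul, one_mul, add_comm]
    refine add_le_add (ih fun y hy => ht y (Finset.mem_insert_of_mem hy)) ?_
    rw [LinearMap.span_singleton_eq_range, ← Submodule.map_top, ← relLength_comap,
      ← relLength_top]
    exact relLength_anti_left _ fun a ha => ht x (Finset.mem_insert_self _ _) a ha

/-- A power of a submodule generated by `r + 1` elements has at most as many generators as
there are monomials. -/
lemma exists_finset_span_eq_pow (r : ℕ) : ∀ s : Finset C, s.card ≤ r + 1 → ∀ n : ℕ,
    ∃ t : Finset C, t.card ≤ (n + 1) ^ r ∧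
      Submodule.span R (t : Set C) = Submodule.span R (s : Set C) ^ n := by
  classical
  induction r with
  | zero =>
    intro s hs n
    refine ⟨s ^ n, ?_, ?_⟩
    · rw [pow_zero]
      exact Finset.card_pow_le.trans (pow_le_one₀ (Nat.zero_le _) hs)
    · rw [Submodule.span_pow, Finset.coe_pow]
  | succ r ih =>
    intro s hs
    by_cases hs' : s.card ≤ r + 1
    · intro n
      obtain ⟨t, ht, ht'⟩ := ih s hs' n
      exact ⟨t, ht.trans (Nat.pow_le_pow_right (by omega) (by omega)), ht'⟩
    obtain ⟨x, s', hx, rfl, hcard⟩ := Finset.card_eq_succ.1 (show s.card = (r + 1) + 1 by omega)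
    intro n
    induction n with
    | zero => exact ⟨{1}, by simp, by simp [Submodule.one_eq_span]⟩
    | succ n hn =>
      obtain ⟨t, ht, ht'⟩ := hn
      obtain ⟨t₁, ht₁, ht₁'⟩ := ih s' hcard.le (n + 1)
      refine ⟨{x} * t ∪ t₁, ?_, ?_⟩
      · have h1 : ({x} * t : Finset C).card ≤ t.card :=
          Finset.card_mul_le.trans (by simp)
        calc ({x} * t ∪ t₁).card ≤ (n + 1) ^ (r + 1) + (n + 1 + 1) ^ r :=
              (Finset.card_union_le _ _).trans (add_le_add (h1.trans ht) ht₁)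
          _ ≤ (n + 1 + 1) ^ r * (n + 1) + (n + 1 + 1) ^ r := by
              rw [pow_succ]
              gcongr
              omega
          _ = (n + 1 + 1) ^ (r + 1) := by ring
      -- Monomials of degree `n + 1` either contain the generator `x` or involve only the others;
      -- this is the recursion behind the count.
      · have key : ∀ (X Y : Submodule R C) (n : ℕ),
            (X ⊔ Y) ^ (n + 1) = X * (X ⊔ Y) ^ n ⊔ Y ^ (n + 1) := by
          intro X Y n
          induction n with
          | zero => simp
          | succ n ih =>
            have hle : Y * (X * (X ⊔ Y) ^ n) ≤ X * (X ⊔ Y) ^ (n + 1) := by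
              rw [mul_left_comm, pow_succ' _ n]
              exact mul_le_mul_right (mul_le_mul_left le_sup_right _) _
            conv_lhs => rw [pow_succ', Submodule.sup_mul]
            conv_lhs => rw [ih, Submodule.mul_sup Y, ← ih, ← pow_succ', ← sup_assoc]
            rw [sup_eq_left.2 hle]
        rw [Finset.coe_union, Submodule.span_union, Finset.coe_mul, ← Submodule.span_mul_span, ht',
          ht₁', Finset.coe_insert, Finset.coe_singleton, Submodule.span_insert, key]

end Generators

/-! ### Growth of the Hilbert-Samuel function -/

section HilbertSamuel

variable {R : Type*} [CommRing R]

lemma relLength_pow_ne_top [IsNoetherianRing R] (I : Ideal R)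
    (hI : Module.length R (R ⧸ I) ≠ ⊤) (n : ℕ) :
    relLength (I ^ n : Ideal R) (⊤ : Ideal R) ≠ ⊤ := by
  induction n with
  | zero => rw [pow_zero, Ideal.one_eq_top, relLength_eq_zero_iff.2 le_rfl]; simp
  | succ n ih =>
    obtain ⟨t, ht⟩ := (isNoetherianRing_iff_ideal_fg R).1 ‹_› (I ^ n)
    replace ht : Submodule.span R (t : Set R) = I ^ n := ht
    rw [relLength_add (Ideal.pow_le_pow_right n.le_succ) le_top]
    refine WithTop.add_ne_top.2 ⟨?_, ih⟩
    have h := relLength_span_le (I ^ (n + 1)) I t (fun x hx a ha => by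
      rw [pow_succ', smul_eq_mul]
      exact Ideal.mul_mem_mul ha (ht ▸ Submodule.subset_span hx))
    rw [ht] at h
    exact ne_top_of_le_ne_top
      (WithTop.mul_ne_top (ENat.natCast_ne_top _) hI) h

lemma length_quotient_maximalIdeal [IsLocalRing R] :
    Module.length R (R ⧸ IsLocalRing.maximalIdeal R) = 1 := by
  rw [Module.length_eq_one_iff, isSimpleModule_iff_isCoatom]
  exact (IsLocalRing.maximalIdeal.isMaximal R).out

variable [IsLocalRing R] [IsNoetherianRing R]

open IsLocalRing

/-- A local ring of dimension `d` has an ideal of finite colength with `d` generators. -/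
lemma exists_parameter_ideal (d : ℕ) (hd : ringKrullDim R = d) :
    ∃ s : Finset R, s.card ≤ d ∧ Ideal.span (s : Set R) ≤ maximalIdeal R ∧
      Module.length R (R ⧸ Ideal.span (s : Set R)) ≠ ⊤ := by
  have hm : (maximalIdeal R).height = d := by
    have := IsLocalRing.maximalIdeal_height_eq_ringKrullDim (R := R)
    rw [hd] at this
    exact_mod_cast this
  obtain ⟨J, hJ, hJ₁, hJ₂⟩ :=
    (maximalIdeal R).exists_spanRank_eq_and_height_eq (Ideal.IsPrime.ne_top inferInstance)
  have hfg : J.FG := (isNoetherianRing_iff_ideal_fg R).1 ‹_› J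
  obtain ⟨s, hs, hs'⟩ := Submodule.FG.exists_span_finset_card_eq_spanFinrank hfg
  have hsJ : Ideal.span (s : Set R) = J := hs'
  refine ⟨s, ?_, hsJ.trans_le hJ, ?_⟩
  · rw [hs]
    rw [Submodule.FG.spanRank_eq_spanFinrank hfg, hm] at hJ₁
    have : J.spanFinrank = d := by simpa using hJ₁
    exact this.le
  rw [hsJ]
  -- A minimal prime of `J` strictly below the maximal ideal would have smaller height than `J`.
  have hrad : maximalIdeal R ≤ J.radical := by
    rw [Ideal.radical_eq_sInf]
    refine le_sInf fun P hP => ?_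
    have := hP.2
    by_contra hne
    have hlt : P < maximalIdeal R := lt_of_le_not_ge (le_maximalIdeal hP.2.ne_top) hne
    have h1 := Ideal.height_strict_mono_of_isPrime_of_isPrime hlt
    exact absurd h1 (not_lt.2 (hJ₂ ▸ Ideal.height_mono hP.1))
  obtain ⟨a, ha⟩ := Ideal.exists_pow_le_of_le_radical_of_fg hrad
    ((isNoetherianRing_iff_ideal_fg R).1 ‹_› _)
  rw [← relLength_top]
  exact ne_top_of_le_ne_top
    (relLength_pow_ne_top (maximalIdeal R) (by rw [length_quotient_maximalIdeal]; simp) a)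
    (relLength_anti_left _ ha)

/-- The Hilbert-Samuel function grows at most like the power `d` of the exponent. -/
theorem exists_length_pow_le (d : ℕ) (hd : ringKrullDim R = d) (hd0 : 0 < d) :
    ∃ c : ℕ, ∀ n : ℕ, Module.length R (R ⧸ maximalIdeal R ^ n) ≤ c * n ^ d := by
  obtain ⟨s, hs, hsm, hfin⟩ := exists_parameter_ideal d hd
  set Q := Ideal.span (s : Set R) with hQ
  obtain ⟨r, rfl⟩ : ∃ r, d = r + 1 := ⟨d - 1, by omega⟩
  refine ⟨(Module.length R (R ⧸ Q)).toNat, fun n => ?_⟩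
  rw [ENat.natCast_toNat hfin, ← relLength_top]
  refine (relLength_anti_left _ (Ideal.pow_right_mono hsm n)).trans ?_
  induction n with
  | zero => rw [pow_zero, Ideal.one_eq_top, relLength_eq_zero_iff.2 le_rfl]; simp
  -- `Q ^ n / Q ^ (n + 1)` is a module over `R ⧸ Q` with at most `(n + 1) ^ r` generators, and `(n +
  -- 1) ^ r + n ^ (r + 1) ≤ (n + 1) ^ (r + 1)`.
  | succ n ih =>
    obtain ⟨t, ht, ht'⟩ := exists_finset_span_eq_pow (R := R) r s hs n
    replace ht' : Submodule.span R (t : Set R) = Q ^ n := ht'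
    have h := relLength_span_le (Q ^ (n + 1)) Q t (fun x hx a ha => by
      rw [pow_succ', smul_eq_mul]
      exact Ideal.mul_mem_mul ha (ht' ▸ Submodule.subset_span hx))
    rw [ht'] at h
    rw [relLength_add (Ideal.pow_le_pow_right n.le_succ) le_top]
    refine (add_le_add h ih).trans ?_
    rw [mul_comm, ← mul_add]
    gcongr
    norm_cast
    calc t.card + n ^ (r + 1) ≤ (n + 1) ^ r + (n + 1) ^ r * n := by
          rw [pow_succ n]
          gcongr
          omega
      _ = (n + 1) ^ (r + 1) := by ring

-- By Artin-Rees in `R ⧸ P`, where `x` is a nonzerodivisor, `r * x ∈ P + I ^ N` implies `r ∈ P + I ^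
-- (N - c)`. So the submodule generated by `x` in `R / (P + I ^ N)` surjects onto `R / (P + I ^ (N -
-- c))`.
omit [IsLocalRing R] in
lemma exists_relLength_sup_pow_ge (P : Ideal R) [P.IsPrime] {x : R} (hx : x ∉ P) (I : Ideal R) :
    ∃ c : ℕ, ∀ N, c ≤ N →
      relLength (P ⊔ I ^ (N - c)) (⊤ : Ideal R) +
          relLength (P ⊔ Ideal.span {x} ⊔ I ^ N) (⊤ : Ideal R)
        ≤ relLength (P ⊔ I ^ N) (⊤ : Ideal R) := by
  obtain ⟨c, hc⟩ := I.exists_pow_inf_eq_pow_smul (M := R ⧸ P)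
    (Submodule.span R {Ideal.Quotient.mk P x})
  refine ⟨c, fun N hN => ?_⟩
  have hle : P ⊔ I ^ N ≤ Ideal.span {x} ⊔ (P ⊔ I ^ N) := le_sup_right
  rw [relLength_add hle le_top, relLength_sup_right, sup_right_comm, sup_comm (P ⊔ I ^ N)]
  gcongr
  have hspan : Ideal.span {x} = (⊤ : Submodule R R).map (LinearMap.mulRight R x) := by
    rw [Submodule.map_top]
    exact LinearMap.span_singleton_eq_range R R x
  rw [hspan, ← relLength_comap]
  refine relLength_anti_left _ fun r hr => ?_
  obtain ⟨p, hp, y, hy, hpy⟩ := Submodule.mem_sup.1 (Submodule.mem_comap.1 hr)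
  have hpy' : p + y = r * x := hpy
  have hmk : r • Ideal.Quotient.mk P x = y • (1 : R ⧸ P) := by
    have h1 : Ideal.Quotient.mk P (r * x) = Ideal.Quotient.mk P y := by
      rw [← hpy', map_add, Ideal.Quotient.eq_zero_iff_mem.2 hp, zero_add]
    rw [Algebra.smul_def, Algebra.smul_def, mul_one]
    simpa using h1
  have hmem : r • Ideal.Quotient.mk P x ∈ I ^ (N - c) •
      (I ^ c • (⊤ : Submodule R (R ⧸ P)) ⊓ Submodule.span R {Ideal.Quotient.mk P x}) := by
    rw [← hc N hN]
    refine ⟨?_, Submodule.smul_mem _ _ (Submodule.mem_span_singleton_self _)⟩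
    rw [hmk]
    exact Submodule.smul_mem_smul hy Submodule.mem_top
  replace hmem := Submodule.smul_mono le_rfl inf_le_right hmem
  obtain ⟨s, hs, hsx⟩ := Submodule.mem_smul_span_singleton.1 hmem
  have hzero : (r - s) * x ∈ P := by
    rw [← Ideal.Quotient.eq_zero_iff_mem, map_mul, map_sub, sub_mul, sub_eq_zero]
    simpa [Algebra.smul_def] using hsx.symm
  rw [← sub_add_cancel r s]
  exact add_mem (Submodule.mem_sup_left ((Ideal.IsPrime.mem_or_mem ‹_› hzero).resolve_right hx))
    (Submodule.mem_sup_right hs)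

/-- Each step of the chain gains a factor `n`: with `x ∈ P 1 \ P 0`, the preceding inequality is
applied `n` times. The ideal `J` is there because the induction hypothesis is used for `P 0 + (x)`,
which need not be prime. -/
lemma exists_pow_le_relLength_of_chain (d : ℕ) : ∀ P : ℕ → Ideal R,
    (∀ i ≤ d, (P i).IsPrime) → (∀ i < d, P i < P (i + 1)) → ∀ J ≤ P 0,
    ∃ a : ℕ, 0 < a ∧ ∀ n : ℕ, 0 < n →
      (n ^ d : ℕ∞) ≤ a * relLength (J ⊔ maximalIdeal R ^ (a * n)) (⊤ : Ideal R) := by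
  induction d with
  | zero =>
    intro P hP _ J hJ
    refine ⟨1, one_pos, fun n hn => ?_⟩
    rw [pow_zero, Nat.cast_one, one_mul, one_mul, Order.one_le_iff_ne_zero, Ne,
      relLength_eq_zero_iff]
    intro h
    have hle : J ⊔ maximalIdeal R ^ n ≤ maximalIdeal R :=
      sup_le (hJ.trans (le_maximalIdeal (hP 0 le_rfl).ne_top)) (Ideal.pow_le_self hn.ne')
    exact (maximalIdeal.isMaximal R).ne_top (top_le_iff.1 (h.trans hle))
  | succ d ih =>
    intro P hP hlt J hJ
    have := hP 0 (by omega)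
    obtain ⟨x, hx1, hx0⟩ := SetLike.exists_of_lt (hlt 0 (by omega))
    obtain ⟨a, ha, hbound⟩ := ih (fun i => P (i + 1)) (fun i hi => hP _ (by omega))
      (fun i hi => hlt _ (by omega)) (P 0 ⊔ Ideal.span {x})
      (sup_le (hlt 0 (by omega)).le ((Ideal.span_singleton_le_iff_mem _).2 hx1))
    obtain ⟨c, hc⟩ := exists_relLength_sup_pow_ge (P 0) hx0 (maximalIdeal R)
    refine ⟨a + c, by omega, fun n hn => ?_⟩
    have key : ∀ i : ℕ, i * relLength (P 0 ⊔ Ideal.span {x} ⊔ maximalIdeal R ^ (a * n))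
        (⊤ : Ideal R) ≤ relLength (P 0 ⊔ maximalIdeal R ^ (a * n + c * i)) (⊤ : Ideal R) := by
      intro i
      induction i with
      | zero => simp
      | succ i ihi =>
        have h := hc (a * n + c * (i + 1)) (by rw [mul_add]; omega)
        have he : a * n + c * (i + 1) - c = a * n + c * i := by rw [mul_add]; omega
        rw [he] at h
        refine le_trans ?_ h
        push_cast
        rw [add_mul, one_mul]
        exact add_le_add ihi (relLength_anti_left _
          (sup_le_sup_left (Ideal.pow_le_pow_right (Nat.le_add_right _ _)) _))
    calc ((n ^ (d + 1) : ℕ) : ℕ∞) = n * n ^ d := by push_cast; ring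
      _ ≤ n * (a * relLength (P 0 ⊔ Ideal.span {x} ⊔ maximalIdeal R ^ (a * n)) (⊤ : Ideal R)) := by
          gcongr; exact_mod_cast hbound n hn
      _ = a * (n * relLength (P 0 ⊔ Ideal.span {x} ⊔ maximalIdeal R ^ (a * n)) (⊤ : Ideal R)) :=
          mul_left_comm _ _ _
      _ ≤ a * relLength (P 0 ⊔ maximalIdeal R ^ (a * n + c * n)) (⊤ : Ideal R) := by
          gcongr; exact key n
      _ ≤ ((a + c : ℕ) : ℕ∞) * relLength (J ⊔ maximalIdeal R ^ ((a + c) * n)) (⊤ : Ideal R) := by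
          rw [add_mul]
          gcongr
          · omega
          · exact relLength_anti_left _ (sup_le_sup_right hJ _)

/-- The Hilbert-Samuel function grows at least like the power `d` of the exponent. -/
theorem exists_pow_le_length (d : ℕ) (hd : ringKrullDim R = d) :
    ∃ a : ℕ, 0 < a ∧ ∀ n : ℕ, 0 < n →
      (n ^ d : ℕ∞) ≤ a * Module.length R (R ⧸ maximalIdeal R ^ (a * n)) := by
  obtain ⟨l, hl⟩ := Order.le_krullDim_iff.1 hd.ge
  obtain ⟨a, ha, h⟩ := exists_pow_le_relLength_of_chain d
    (fun i => (l (Fin.ofNat (l.length + 1) i)).asIdeal) (fun i _ => (l _).isPrime)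
    (fun i hi => l.strictMono (by
      simp only [Fin.lt_def, Fin.ofNat]
      rw [Nat.mod_eq_of_lt (by omega), Nat.mod_eq_of_lt (by omega)]
      omega)) ⊥ bot_le
  refine ⟨a, ha, fun n hn => ?_⟩
  have := h n hn
  rwa [bot_sup_eq, relLength_top] at this

end HilbertSamuel

/-! ### Total degree from growth along rays -/

section Growth

open Filter Topology

lemma degree_le_of_abs_eval_le (F G : Polynomial ℚ)
    (h : ∃ K : ℚ, ∃ c₀ : ℕ, ∀ c : ℕ, c₀ ≤ c → |G.eval (c : ℚ)| ≤ K * |F.eval (c : ℚ)|) :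
    G.degree ≤ F.degree := by
  by_contra hlt
  rw [not_le] at hlt
  obtain ⟨K, c₀, h⟩ := h
  have hG : G ≠ 0 := by rintro rfl; simp at hlt
  have h1 := ((Polynomial.div_tendsto_atTop_zero_of_degree_lt F G hlt).abs.comp
    (tendsto_natCast_atTop_atTop (R := ℚ)))
  rw [abs_zero] at h1
  have h2 := (tendsto_natCast_atTop_atTop (R := ℚ)).eventually
    (Polynomial.eventually_atTop_not_isRoot G hG)
  have hK : (0 : ℚ) < (|K| + 1)⁻¹ := by positivity
  obtain ⟨c, hc1, hc2, hc3⟩ :=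
    ((h1.eventually_lt_const hK).and (h2.and (eventually_ge_atTop c₀))).exists
  have hpos : 0 < |G.eval (c : ℚ)| := abs_pos.2 hc2
  have h3 := h c hc3
  simp only [Function.comp_apply, abs_div] at hc1
  rw [div_lt_iff₀ hpos, inv_mul_eq_div, lt_div_iff₀ (by positivity)] at hc1
  nlinarith [le_abs_self K, abs_nonneg (F.eval (c : ℚ))]

variable {σ : Type*}

lemma eval_mul_of_isHomogeneous {p : MvPolynomial σ ℚ} {i : ℕ} (hp : p.IsHomogeneous i)
    (c : ℚ) (a : σ → ℚ) :
    MvPolynomial.eval (fun k => c * a k) p = c ^ i * MvPolynomial.eval a p := by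
  rw [MvPolynomial.eval_eq, MvPolynomial.eval_eq, Finset.mul_sum]
  refine Finset.sum_congr rfl fun d hd => ?_
  have hdeg : ∑ k ∈ d.support, d k = i := by
    have := hp (MvPolynomial.mem_support_iff.1 hd)
    simpa [Finsupp.weight_apply, Finsupp.sum] using this
  simp_rw [mul_pow, Finset.prod_mul_distrib, Finset.prod_pow_eq_pow_sum, hdeg]
  ring

/-- The restriction of a polynomial to the ray spanned by `a`. -/
noncomputable def rayPolynomial (p : MvPolynomial σ ℚ) (a : σ → ℚ) : Polynomial ℚ :=
  ∑ i ∈ Finset.range (p.totalDegree + 1),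
    Polynomial.monomial i (MvPolynomial.eval a (MvPolynomial.homogeneousComponent i p))

lemma eval_rayPolynomial (p : MvPolynomial σ ℚ) (a : σ → ℚ) (c : ℚ) :
    (rayPolynomial p a).eval c = MvPolynomial.eval (fun k => c * a k) p := by
  conv_rhs => rw [← MvPolynomial.sum_homogeneousComponent p, map_sum]
  rw [rayPolynomial, Polynomial.eval_finsetSum]
  refine Finset.sum_congr rfl fun i _ => ?_
  rw [eval_mul_of_isHomogeneous (MvPolynomial.homogeneousComponent_isHomogeneous i p),
    Polynomial.eval_monomial, mul_comm]

lemma coeff_rayPolynomial (p : MvPolynomial σ ℚ) (a : σ → ℚ) (i : ℕ) :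
    (rayPolynomial p a).coeff i =
      MvPolynomial.eval a (MvPolynomial.homogeneousComponent i p) := by
  simp only [rayPolynomial, Polynomial.finsetSum_coeff, Polynomial.coeff_monomial,
    Finset.sum_ite_eq', Finset.mem_range]
  split_ifs with h
  · rfl
  · rw [MvPolynomial.homogeneousComponent_eq_zero i p (by omega), map_zero]

/-- The total degree of a polynomial is determined by its growth along positive rays. -/
theorem totalDegree_eq_of_growth (p : MvPolynomial σ ℚ) (D : ℕ)
    (hup : ∀ a : σ → ℕ, (∀ k, 0 < a k) → ∃ K : ℚ, ∃ c₀ : ℕ, ∀ c : ℕ, c₀ ≤ c →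
      |MvPolynomial.eval (fun k => (c : ℚ) * a k) p| ≤ K * c ^ D)
    (hlow : ∃ a : σ → ℕ, ∃ K : ℚ, ∃ c₀ : ℕ, ∀ c : ℕ, c₀ ≤ c →
      (c : ℚ) ^ D ≤ K * |MvPolynomial.eval (fun k => (c : ℚ) * a k) p|) :
    p.totalDegree = D := by
  refine le_antisymm ?_ ?_
  -- On each positive ray the coefficient of degree `i` is the value of the homogeneous component of
  -- degree `i`; vanishing at all positive integer points makes that component zero.
  · have hz : ∀ i, D < i → MvPolynomial.homogeneousComponent i p = 0 := by
      intro i hi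
      refine MvPolynomial.funext_set (fun _ => (fun n : ℕ => (n : ℚ)) '' Set.Ioi 0)
        (fun _ => (Set.Ioi_infinite 0).image Nat.cast_injective.injOn) fun x hx => ?_
      choose a ha hax using fun k => hx k (Set.mem_univ k)
      obtain rfl : (fun k => (a k : ℚ)) = x := funext hax
      obtain ⟨K, c₀, h⟩ := hup a ha
      have hdeg := degree_le_of_abs_eval_le (Polynomial.X ^ D)
        (rayPolynomial p fun k => a k) ⟨K, c₀, fun c hc => by
          rw [eval_rayPolynomial]
          simpa using h c hc⟩
      rw [Polynomial.degree_X_pow] at hdeg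
      rw [map_zero, ← coeff_rayPolynomial]
      exact Polynomial.coeff_eq_zero_of_degree_lt (hdeg.trans_lt (by exact_mod_cast hi))
    conv_lhs => rw [← MvPolynomial.sum_homogeneousComponent p]
    refine MvPolynomial.totalDegree_finsetSum_le fun i _ => ?_
    rcases le_or_gt i D with hi | hi
    · exact (MvPolynomial.homogeneousComponent_isHomogeneous i p).totalDegree_le.trans hi
    · rw [hz i hi]; simp
  · obtain ⟨a, K, c₀, h⟩ := hlow
    have hdeg := degree_le_of_abs_eval_le (rayPolynomial p fun k => a k)
      (Polynomial.X ^ D) ⟨K, c₀, fun c hc => by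
        rw [eval_rayPolynomial]
        simpa using h c hc⟩
    rw [Polynomial.degree_X_pow] at hdeg
    by_contra hlt
    have hlt' : (rayPolynomial p fun k => (a k : ℚ)).degree < (D : WithBot ℕ) := by
      rw [Polynomial.degree_lt_iff_coeff_zero]
      intro i hi
      rw [coeff_rayPolynomial, MvPolynomial.homogeneousComponent_eq_zero i p (by omega), map_zero]
    exact absurd hdeg (not_le.2 hlt')

end Growth

/-! ### The auxiliary variable: products of `M + F X` in `B[X]` -/

section ReesAlgebra

open Polynomial

variable {R B σ : Type*} [CommRing R] [CommRing B] [Algebra R B]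

/-- A submodule of `B[X]` with homogeneous components of degree at most `N` only, the coefficients
of which form an increasing chain. -/
def IsGraded (S : Submodule R B[X]) (N : ℕ) : Prop :=
  ∀ p ∈ S, ∀ j, monomial j (p.coeff j) ∈ S ∧ (N < j → p.coeff j = 0) ∧
    (j < N → monomial (j + 1) (p.coeff j) ∈ S)

lemma isGraded_one : IsGraded (1 : Submodule R B[X]) 0 := by
  intro p hp j
  obtain ⟨r, rfl⟩ := Submodule.mem_one.1 hp
  rw [Polynomial.algebraMap_apply, coeff_C]
  refine ⟨?_, fun hj => if_neg hj.ne', fun hj => absurd hj (Nat.not_lt_zero j)⟩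
  split_ifs with h
  · subst h
    exact Submodule.mem_one.2 ⟨r, rfl⟩
  · rw [map_zero]; exact zero_mem _

lemma IsGraded.mul {S T : Submodule R B[X]} {N N' : ℕ} (hS : IsGraded S N) (hT : IsGraded T N') :
    IsGraded (S * T) (N + N') := by
  intro p hp
  induction hp using Submodule.mul_induction_on' with
  | mem_mul_mem s hs t ht =>
    intro j
    rw [coeff_mul]
    refine ⟨?_, fun hj => ?_, fun hj => ?_⟩
    · rw [map_sum]
      refine sum_mem fun a ha => ?_
      rw [← Finset.HasAntidiagonal.mem_antidiagonal.1 ha, ← monomial_mul_monomial]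
      exact Submodule.mul_mem_mul (hS s hs _).1 (hT t ht _).1
    · refine Finset.sum_eq_zero fun a ha => ?_
      have := Finset.HasAntidiagonal.mem_antidiagonal.1 ha
      by_cases h : N < a.1
      · rw [(hS s hs _).2.1 h, zero_mul]
      · rw [(hT t ht _).2.1 (by omega), mul_zero]
    · rw [map_sum]
      refine sum_mem fun a ha => ?_
      have hj' := Finset.HasAntidiagonal.mem_antidiagonal.1 ha
      -- As `j < N + N'`, at least one of the two factors is below its top degree and can be raised.
      by_cases h : a.1 < N
      · rw [show j + 1 = (a.1 + 1) + a.2 by omega, ← monomial_mul_monomial]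
        exact Submodule.mul_mem_mul ((hS s hs _).2.2 h) (hT t ht _).1
      · rw [show j + 1 = a.1 + (a.2 + 1) by omega, ← monomial_mul_monomial]
        exact Submodule.mul_mem_mul (hS s hs _).1 ((hT t ht _).2.2 (by omega))
  | add x _ y _ hx hy =>
    intro j
    rw [coeff_add, map_add, map_add]
    refine ⟨add_mem (hx j).1 (hy j).1, fun hj => ?_,
      fun hj => add_mem ((hx j).2.2 hj) ((hy j).2.2 hj)⟩
    rw [(hx j).2.1 hj, (hy j).2.1 hj, add_zero]

/-- The submodule `M + F X` of `B[X]`. -/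
noncomputable def reesGen (M F : Submodule R B) : Submodule R B[X] :=
  M.map (CAlgHom (R := R) (A := B)).toLinearMap ⊔ F.map ((monomial (R := B) 1).restrictScalars R)

lemma mem_reesGen {M F : Submodule R B} {p : B[X]} :
    p ∈ reesGen M F ↔ ∃ m ∈ M, ∃ f ∈ F, C m + monomial 1 f = p := by
  simp [reesGen, Submodule.mem_sup]

lemma isGraded_reesGen {M F : Submodule R B} (h : M ≤ F) : IsGraded (reesGen M F) 1 := by
  intro p hp j
  obtain ⟨m, hm, f, hf, rfl⟩ := mem_reesGen.1 hp
  rw [coeff_add, coeff_C, coeff_monomial]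
  rcases j with _ | _ | j
  · simp only [if_true, if_neg one_ne_zero, add_zero]
    exact ⟨mem_reesGen.2 ⟨m, hm, 0, zero_mem _, by simp⟩, by simp,
      fun _ => mem_reesGen.2 ⟨0, zero_mem _, m, h hm, by simp⟩⟩
  · simp only [zero_add, if_neg one_ne_zero, if_true]
    exact ⟨mem_reesGen.2 ⟨0, zero_mem _, f, hf, by simp⟩, by simp, by simp⟩
  · simp

variable [Fintype σ]

lemma map_multiPow {B' : Type*} [CommRing B'] [Algebra R B'] (f : B →ₐ[R] B')
    (L : σ → Submodule R B) (n : σ → ℕ) :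
    (multiPow L n).map f.toLinearMap = multiPow (fun k => (L k).map f.toLinearMap) n := by
  unfold multiPow
  change Submodule.mapHom f _ = ∏ k, (Submodule.mapHom f (L k)) ^ n k
  rw [map_prod]
  simp_rw [map_pow]

lemma multiPow_mono {L L' : σ → Submodule R B} (h : ∀ k, L k ≤ L' k) (n : σ → ℕ) :
    multiPow L n ≤ multiPow L' n :=
  Finset.prod_le_prod' fun k _ => pow_le_pow_left' (h k) _

variable [DecidableEq σ] {Ms Fs : σ → Submodule R B}

lemma isGraded_multiPow (h : ∀ k, Ms k ≤ Fs k) (n : σ → ℕ) :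
    IsGraded (multiPow (fun k => reesGen (Ms k) (Fs k)) n) (∑ k, n k) := by
  induction n using exponent_induction with
  | h0 => simpa [multiPow_zero] using isGraded_one
  | hadd m n hm hn =>
    simp only [multiPow_add, Pi.add_apply, Finset.sum_add_distrib]
    exact hm.mul hn
  | hsingle k =>
    simpa [multiPow_single] using isGraded_reesGen (h k)

-- Setting `X = 0` sends `M + F X` into `M`.
omit [DecidableEq σ] in
lemma C_mem_multiPow_reesGen_iff (n : σ → ℕ) (b : B) :
    C b ∈ multiPow (fun k => reesGen (Ms k) (Fs k)) n ↔ b ∈ multiPow Ms n := by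
  constructor
  · intro hb
    have h := Submodule.mem_map_of_mem (f := ((aeval (0 : B)).restrictScalars R).toLinearMap) hb
    rw [map_multiPow] at h
    have hk : ∀ k, (reesGen (Ms k) (Fs k)).map ((aeval (0 : B)).restrictScalars R).toLinearMap ≤
        Ms k := by
      intro k
      rintro _ ⟨p, hp, rfl⟩
      obtain ⟨m, hm, f, hf, rfl⟩ := mem_reesGen.1 hp
      simpa [aeval_monomial] using hm
    simpa using multiPow_mono hk n h
  · intro hb
    have h := Submodule.mem_map_of_mem (f := (CAlgHom (R := R) (A := B)).toLinearMap) hb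
    rw [map_multiPow] at h
    exact multiPow_mono (fun k => le_sup_left) n h

/-- Setting `X = 1` sends `M + F X` into `F`; conversely the top degree takes `F X` from every
factor. -/
lemma monomial_mem_multiPow_reesGen_iff (hMF : ∀ k, Ms k ≤ Fs k) (n : σ → ℕ) (b : B) :
    monomial (∑ k, n k) b ∈ multiPow (fun k => reesGen (Ms k) (Fs k)) n ↔ b ∈ multiPow Fs n := by
  constructor
  · intro hb
    have h := Submodule.mem_map_of_mem (f := ((aeval (1 : B)).restrictScalars R).toLinearMap) hb
    rw [map_multiPow] at h
    have hk : ∀ k, (reesGen (Ms k) (Fs k)).map ((aeval (1 : B)).restrictScalars R).toLinearMap ≤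
        Fs k := by
      intro k
      rintro _ ⟨p, hp, rfl⟩
      obtain ⟨m, hm, f, hf, rfl⟩ := mem_reesGen.1 hp
      simpa [aeval_monomial] using add_mem (hMF k hm) hf
    simpa [aeval_monomial] using multiPow_mono hk n h
  · revert b
    induction n using exponent_induction with
    | h0 =>
      intro b hb
      rw [multiPow_zero] at hb ⊢
      obtain ⟨r, rfl⟩ := Submodule.mem_one.1 hb
      refine Submodule.mem_one.2 ⟨r, ?_⟩
      simp [Polynomial.algebraMap_apply]
    | hadd m n hm hn =>
      intro b hb
      rw [multiPow_add] at hb ⊢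
      simp only [Pi.add_apply, Finset.sum_add_distrib]
      induction hb using Submodule.mul_induction_on' with
      | mem_mul_mem x hx y hy =>
        rw [← monomial_mul_monomial]
        exact Submodule.mul_mem_mul (hm x hx) (hn y hy)
      | add x _ y _ hx hy => rw [map_add]; exact add_mem hx hy
    | hsingle k =>
      intro b hb
      rw [multiPow_single] at hb ⊢
      have hs : ∑ l, (Pi.single k 1 : σ → ℕ) l = 1 := by simp
      rw [hs]
      exact mem_reesGen.2 ⟨0, zero_mem _, b, hb, by simp⟩

/-- The coefficients of degree `j` of a submodule of `B[X]`. -/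
noncomputable def gradedPart (S : Submodule R B[X]) (j : ℕ) : Submodule R B :=
  S.comap ((monomial (R := B) j).restrictScalars R)

omit [Fintype σ] [DecidableEq σ] in
lemma mem_gradedPart {S : Submodule R B[X]} {j : ℕ} {b : B} :
    b ∈ gradedPart S j ↔ monomial j b ∈ S := Iff.rfl

lemma IsGraded.gradedPart_le {S : Submodule R B[X]} {N : ℕ} (hS : IsGraded S N) {j : ℕ}
    (hj : j < N) : gradedPart S j ≤ gradedPart S (j + 1) := fun b hb => by
  have := (hS _ hb j).2.2 hj
  exact mem_gradedPart.2 (by simpa using this)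

lemma IsGraded.relLength_gradedPart {S : Submodule R B[X]} {N : ℕ} (hS : IsGraded S N) (J : ℕ)
    (hJ : J ≤ N) : gradedPart S 0 ≤ gradedPart S J ∧
      relLength (gradedPart S 0) (gradedPart S J) =
        ∑ j ∈ Finset.range J, relLength (gradedPart S j) (gradedPart S (j + 1)) := by
  induction J with
  | zero => exact ⟨le_rfl, by simpa using relLength_eq_zero_iff.2 le_rfl⟩
  | succ J ih =>
    obtain ⟨h1, h2⟩ := ih (by omega)
    have h3 := hS.gradedPart_le (show J < N by omega)
    exact ⟨h1.trans h3, by rw [relLength_add h1 h3, h2, Finset.sum_range_succ]⟩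

/-- The polynomials in `S` without constant coefficient. -/
noncomputable def positivePart (S : Submodule R B[X]) : Submodule R B[X] :=
  S ⊓ LinearMap.ker ((lcoeff B 0).restrictScalars R)

/-- The elements of `S` which are `X` times an element of `S`. -/
noncomputable def shiftPart (S : Submodule R B[X]) : Submodule R B[X] :=
  S ⊓ S.map (LinearMap.mulLeft R X)

lemma shiftPart_le_positivePart (S : Submodule R B[X]) : shiftPart S ≤ positivePart S := by
  rintro _ ⟨h, q, hq, rfl⟩
  exact ⟨h, by simp⟩

/-- Sending a polynomial to the classes of its coefficients of degree `j + 1` modulo the degree `j`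
part identifies the left quotient with the direct sum of the steps of the chain from degree `0` to
degree `N`. -/
lemma IsGraded.relLength_shiftPart {S : Submodule R B[X]} {N : ℕ} (hS : IsGraded S N) :
    relLength (shiftPart S) (positivePart S) =
      relLength (gradedPart S 0) (gradedPart S N) := by
  let g : positivePart S →ₗ[R]
      (∀ j : Fin N, (gradedPart S (j + 1)).map (gradedPart S j).mkQ) :=
    LinearMap.pi fun j => (((gradedPart S j).mkQ ∘ₗ (lcoeff B (j + 1)).restrictScalars R) ∘ₗ
      (positivePart S).subtype).codRestrict _ fun u => ⟨_, (hS u u.2.1 (j + 1)).1, rfl⟩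
  have hg : ∀ u (j : Fin N),
      (g u j : B ⧸ gradedPart S j) = (gradedPart S j).mkQ (u.1.coeff (j + 1)) :=
    fun u j => rfl
  rw [relLength_eq_of_surjective
      (V' := ∀ j : Fin N, (gradedPart S (j + 1)).map (gradedPart S j).mkQ) _ _ g,
    Module.length_pi_of_fintype, (hS.relLength_gradedPart N le_rfl).2, Finset.sum_range]
  · simp_rw [relLength_eq_length_map]
  · intro y
    choose e he hey using fun j => (y j).2
    have hmem : ∑ j : Fin N, monomial (j + 1) (e j) ∈ positivePart S := by
      refine ⟨sum_mem fun j _ => he j, ?_⟩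
      simp [coeff_monomial]
    refine ⟨⟨_, hmem⟩, ?_⟩
    ext j
    rw [hg, ← hey j]
    congr 1
    simp only [finsetSum_coeff, coeff_monomial, add_left_inj, ← Fin.ext_iff]
    simp
  · ext u
    have hmem : u ∈ LinearMap.ker g ↔ ∀ j : Fin N, u.1.coeff (j + 1) ∈ gradedPart S j := by
      rw [LinearMap.mem_ker, funext_iff]
      refine forall_congr' fun j => ?_
      rw [Subtype.ext_iff, hg]
      simp
    rw [hmem]
    constructor
    · intro h
      refine ⟨u.2.1, ∑ j : Fin N, monomial j (u.1.coeff (j + 1)), sum_mem fun j _ => h j, ?_⟩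
      ext i
      rw [LinearMap.mulLeft_apply]
      rcases i with _ | i
      · simpa using (u.2.2 : u.1.coeff 0 = 0).symm
      · rw [coeff_X_mul, finsetSum_coeff]
        simp only [coeff_monomial]
        by_cases hi : i < N
        · rw [Finset.sum_eq_single ⟨i, hi⟩]
          · simp
          · intro j _ hj
            rw [if_neg fun h => hj (Fin.ext h)]
          · simp
        · rw [Finset.sum_eq_zero fun j _ => if_neg (by omega)]
          exact ((hS u u.2.1 (i + 1)).2.1 (by omega)).symm
    · rintro ⟨_, q, hq, hqu⟩ j
      have : u.1.coeff (j + 1) = q.coeff j := by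
        rw [← coeff_X_mul q]
        exact congrArg (fun p => p.coeff (j + 1)) hqu.symm
      rw [this]
      exact (hS q hq j).1

lemma isStable_multiPow (L : σ → Submodule R B) : IsStable L (multiPow L) := fun k n y hy u hu => by
  rw [multiPow_add, multiPow_single, mul_comm y]
  exact Submodule.mul_mem_mul hu hy

/-- For finitely generated `Ms k ≤ Fs k`, the length of `∏ Fs k ^ n k / ∏ Ms k ^ n k` is an
eventually polynomial function of `n`. -/
theorem exists_mvPolynomial_eq_relLength_multiPow [IsNoetherianRing R] (hMF : ∀ k, Ms k ≤ Fs k)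
    (hM : ∀ k, (Ms k).FG) (hF : ∀ k, (Fs k).FG)
    (hfin : ∀ n, relLength (multiPow Ms n) (multiPow Fs n) ≠ ⊤) :
    ∃ p : MvPolynomial σ ℚ, ∃ N : ℕ, ∀ n : σ → ℕ, (∀ k, N ≤ n k) →
      ((relLength (multiPow Ms n) (multiPow Fs n)).toNat : ℚ) =
        MvPolynomial.eval (fun k => (n k : ℚ)) p := by
  let L : σ → Submodule R B[X] := fun k => reesGen (Ms k) (Fs k)
  have hlen : ∀ n, relLength (shiftPart (multiPow L n)) (positivePart (multiPow L n)) =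
      relLength (multiPow Ms n) (multiPow Fs n) := by
    intro n
    rw [(isGraded_multiPow hMF n).relLength_shiftPart]
    congr 1
    · ext b
      exact C_mem_multiPow_reesGen_iff n b
    · ext b
      exact monomial_mem_multiPow_reesGen_iff hMF n b
  -- Both parts are stable under multiplication by `L`, so the Hilbert function theorem applies in
  -- the exponents `n` alone; the degree in `X` is not used as a grading there.
  have hQ := isStable_multiPow L
  obtain ⟨p, N, h⟩ := exists_mvPolynomial_eq_hilbertFunction (L := L)
    (W := fun n => shiftPart (multiPow L n)) (U := fun n => positivePart (multiPow L n))
    (fun k => ((hM k).map _).sup ((hF k).map _))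
    (fun k n y hy u hu => by
      obtain ⟨hu, q, hq, rfl⟩ := hu
      refine ⟨hQ k n y hy _ hu, y * q, hQ k n y hy q hq, ?_⟩
      simp [mul_left_comm])
    (fun k n y hy u hu => ⟨hQ k n y hy u hu.1, by
      have h0 : u.coeff 0 = 0 := hu.2
      simp [mul_coeff_zero, h0]⟩)
    (fun n => shiftPart_le_positivePart _) (fun n => inf_le_left)
    (fun n => by rw [hlen]; exact hfin n)
  refine ⟨p, N, fun n hn => ?_⟩
  rw [← h n hn, hilbertFunction, hlen]

end ReesAlgebra

/-! ### Upper bound: annihilators and generators -/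

section UpperBound

open IsLocalRing

variable {R B σ : Type*} [CommRing R] [CommRing B] [Algebra R B] [Fintype σ]

/-- The chain `𝔪 ^ i (F ⧸ M)` stops since `F ⧸ M` is Artinian, and Nakayama makes its limit zero. -/
lemma exists_pow_smul_mem [IsLocalRing R] [IsNoetherianRing R] {F : Type*} [AddCommGroup F]
    [Module R F] (M : Submodule R F) (hM : Module.length R (F ⧸ M) ≠ ⊤) :
    ∃ s : ℕ, ∀ a ∈ maximalIdeal R ^ s, ∀ x : F, a • x ∈ M := by
  rw [Module.length_ne_top_iff, isFiniteLength_iff_isNoetherian_isArtinian] at hM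
  obtain ⟨_, _⟩ := hM
  let f : ℕ →o (Submodule R (F ⧸ M))ᵒᵈ :=
    ⟨fun i => OrderDual.toDual (maximalIdeal R ^ i • (⊤ : Submodule R (F ⧸ M))),
      fun i j hij => Submodule.smul_mono_left (Ideal.pow_le_pow_right hij)⟩
  obtain ⟨s, hs⟩ := IsArtinian.monotone_stabilizes f
  have h1 : maximalIdeal R ^ s • (⊤ : Submodule R (F ⧸ M)) =
      maximalIdeal R ^ (s + 1) • (⊤ : Submodule R (F ⧸ M)) := hs (s + 1) s.le_succ
  have h2 : maximalIdeal R ^ s • (⊤ : Submodule R (F ⧸ M)) = ⊥ := by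
    refine Submodule.eq_bot_of_le_smul_of_le_jacobson_bot (maximalIdeal R) _
      (IsNoetherian.noetherian _) ?_ (maximalIdeal_le_jacobson _)
    rw [← mul_smul, ← pow_succ', ← h1]
  refine ⟨s, fun a ha x => ?_⟩
  have h3 : a • M.mkQ x ∈ maximalIdeal R ^ s • (⊤ : Submodule R (F ⧸ M)) :=
    Submodule.smul_mem_smul ha Submodule.mem_top
  rw [h2, Submodule.mem_bot, ← map_smul, Submodule.mkQ_apply,
    Submodule.Quotient.mk_eq_zero] at h3
  exact h3

/-- One factor from `I` is spent on each factor of the product. -/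
lemma pow_smul_mem_multiPow [DecidableEq σ] {Ms Fs : σ → Submodule R B} (I : Ideal R)
    (h : ∀ k, ∀ a ∈ I, ∀ x ∈ Fs k, a • x ∈ Ms k) (n : σ → ℕ) :
    ∀ a ∈ I ^ (∑ k, n k), ∀ x ∈ multiPow Fs n, a • x ∈ multiPow Ms n := by
  induction n using exponent_induction with
  | h0 =>
    intro a _ x hx
    rw [multiPow_zero] at hx ⊢
    exact Submodule.smul_mem _ _ hx
  | hadd m n hm hn =>
    intro a ha x hx
    simp only [Pi.add_apply, Finset.sum_add_distrib, pow_add] at ha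
    rw [multiPow_add] at hx ⊢
    induction ha using Submodule.mul_induction_on' with
    | mem_mul_mem a ha b hb =>
      induction hx using Submodule.mul_induction_on' with
      | mem_mul_mem x hx y hy =>
        rw [← smul_mul_smul_comm]
        exact Submodule.mul_mem_mul (hm a ha x hx) (hn b hb y hy)
      | add x _ y _ hx hy => rw [smul_add]; exact add_mem hx hy
    | add a _ b _ ha hb => rw [add_smul]; exact add_mem ha hb
  | hsingle k =>
    simpa [multiPow_single] using h k

open scoped Pointwise in
lemma exists_finset_span_eq_multiPow {Fs : σ → Submodule R B} (ρ : σ → ℕ)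
    (hF : ∀ k, ∃ s : Finset B, s.card ≤ ρ k + 1 ∧ Submodule.span R (s : Set B) = Fs k)
    (n : σ → ℕ) :
    ∃ t : Finset B, t.card ≤ ∏ k, (n k + 1) ^ ρ k ∧
      Submodule.span R (t : Set B) = multiPow Fs n := by
  classical
  choose s hs hs' using hF
  choose t ht ht' using fun k => exists_finset_span_eq_pow (R := R) (ρ k) (s k) (hs k) (n k)
  refine ⟨∏ k, t k, (Finset.le_prod_of_submultiplicative Finset.card
    Finset.card_one.le (fun _ _ => Finset.card_mul_le) _ _).trans
      (Finset.prod_le_prod' fun k _ => ht k), ?_⟩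
  rw [Finset.coe_prod, ← Submodule.prod_span]
  exact Finset.prod_congr rfl fun k _ => by rw [ht', hs']

lemma relLength_multiPow_le [DecidableEq σ] {Ms Fs : σ → Submodule R B} (I : Ideal R)
    (h : ∀ k, ∀ a ∈ I, ∀ x ∈ Fs k, a • x ∈ Ms k) (ρ : σ → ℕ)
    (hF : ∀ k, ∃ s : Finset B, s.card ≤ ρ k + 1 ∧ Submodule.span R (s : Set B) = Fs k)
    (n : σ → ℕ) :
    relLength (multiPow Ms n) (multiPow Fs n) ≤
      (∏ k, (n k + 1) ^ ρ k : ℕ) * Module.length R (R ⧸ I ^ ∑ k, n k) := by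
  obtain ⟨t, ht, ht'⟩ := exists_finset_span_eq_multiPow ρ hF n
  have := relLength_span_le (multiPow Ms n) (I ^ ∑ k, n k) t fun x hx a ha =>
    pow_smul_mem_multiPow I h n a ha x (ht' ▸ Submodule.subset_span hx)
  rw [ht'] at this
  refine this.trans ?_
  gcongr

end UpperBound

/-! ### A basis adapted to a proper submodule -/

section LowerBound

open IsLocalRing

variable {R : Type*} [CommRing R] [IsLocalRing R]

/-- A proper submodule of a free module over a local ring is contained in
`𝔪 e₀ ⊕ R e₁ ⊕ ⋯ ⊕ R e_ρ` for some basis `e`. -/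
lemma exists_basis_repr_mem_maximalIdeal [IsNoetherianRing R] {F : Type*} [AddCommGroup F]
    [Module R F] [Module.Free R F] [Module.Finite R F] (M : Submodule R F) (hM : M ≠ ⊤) (ρ : ℕ)
    (hρ : Module.finrank R F = ρ + 1) :
    ∃ b : Module.Basis (Unit ⊕ Fin ρ) R F, ∀ x ∈ M, b.repr x (Sum.inl ()) ∈ maximalIdeal R := by
  obtain ⟨N, hN, hMN⟩ := (eq_top_or_exists_le_coatom M).resolve_left hM
  obtain ⟨I, hI, ⟨ψ⟩⟩ := isSimpleModule_iff_quot_maximal.1 (isSimpleModule_iff_isCoatom.2 hN)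
  obtain rfl := eq_maximalIdeal hI
  -- The projection of `F` onto the residue field with kernel `N ≥ M` lifts to a functional `φ`,
  -- which takes a unit value; hence `F = R e ⊕ ker φ` with `φ e = 1`, and `φ` is the first
  -- coordinate.
  obtain ⟨φ, hφ⟩ := Module.projective_lifting_property (maximalIdeal R).mkQ
    (ψ.toLinearMap ∘ₗ N.mkQ) (Submodule.mkQ_surjective _)
  have hφM : ∀ x ∈ M, φ x ∈ maximalIdeal R := by
    intro x hx
    have h1 : (maximalIdeal R).mkQ (φ x) = ψ (N.mkQ x) := LinearMap.congr_fun hφ x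
    have h2 : N.mkQ x = 0 := (Submodule.Quotient.mk_eq_zero N).2 (hMN hx)
    rw [h2, map_zero] at h1
    exact Ideal.Quotient.eq_zero_iff_mem.1 h1
  obtain ⟨y, hy⟩ : ∃ y, φ y ∉ maximalIdeal R := by
    by_contra! hall
    obtain ⟨z, hz⟩ := (ψ.surjective.comp N.mkQ_surjective) 1
    have := LinearMap.congr_fun hφ z
    have h1 : (maximalIdeal R).mkQ (φ z) = 0 := Ideal.Quotient.eq_zero_iff_mem.2 (hall z)
    have h2 : (1 : R ⧸ maximalIdeal R) = 0 := by
      rw [← hz, ← h1]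
      exact this.symm
    exact one_ne_zero h2
  obtain ⟨u, hu⟩ := (IsLocalRing.notMem_maximalIdeal.1 hy)
  let e : F := (↑u⁻¹ : R) • y
  have he : φ e = 1 := by simp [e, ← hu]
  obtain ⟨s, hsv⟩ : ∃ s : F →ₗ[R] LinearMap.ker φ, ∀ x, (s x : F) = x - φ x • e :=
    ⟨(LinearMap.id - φ.smulRight e).codRestrict _ fun x => by simp [he], fun x => rfl⟩
  have hs : s ∘ₗ (LinearMap.ker φ).subtype = LinearMap.id := by
    ext x
    simp [hsv, LinearMap.mem_ker.1 x.2]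
  have hse : s e = 0 := by
    ext
    simp [hsv, he]
  let E : F ≃ₗ[R] R × LinearMap.ker φ :=
    LinearEquiv.ofLinearMap (φ.prod s)
      ((LinearMap.toSpanSingleton R F e).coprod (LinearMap.ker φ).subtype)
      (by ext x <;> simp [he, hse, hsv]) (by ext x; simp [hsv])
  have : Module.Projective R (LinearMap.ker φ) := Module.Projective.of_split _ s hs
  have : Module.Free R (LinearMap.ker φ) := Module.free_of_flat_of_isLocalRing
  have hrank : Module.finrank R (LinearMap.ker φ) = ρ := by
    have := E.finrank_eq
    rw [hρ, Module.finrank_prod, Module.finrank_self] at this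
    omega
  let b := ((Module.Basis.singleton Unit R).prod
    (Module.finBasisOfFinrankEq R (LinearMap.ker φ) hrank)).map E.symm
  refine ⟨b, fun x hx => ?_⟩
  have : b.repr x (Sum.inl ()) = φ x := by simp [b, E]
  rw [this]
  exact hφM x hx

end LowerBound

/-! ### Lower bound: counting monomials in the symmetric algebra -/

section Sharpness

open IsLocalRing

variable {R : Type*} [CommRing R] [IsLocalRing R] {q : ℕ} {F : Fin q → Type*}
  [∀ k, AddCommGroup (F k)] [∀ k, Module R (F k)]

/-- A submodule of `F k`, seen in degree one of the symmetric algebra of the direct sum. -/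
noncomputable def symGen (M : ∀ k, Submodule R (F k)) (k : Fin q) :
    Submodule R (SymmetricAlgebra R (∀ k, F k)) :=
  (M k).map (SymmetricAlgebra.ι R (∀ k, F k) ∘ₗ LinearMap.single R F k)

omit [IsLocalRing R] in
lemma symProd_eq_multiPow (M : ∀ k, Submodule R (F k)) (n : Fin q → ℕ) :
    symProd R F M n = multiPow (symGen M) n := by
  unfold symProd multiPow
  exact Finset.prod_congr rfl fun k _ => symImage_eq_pow R F k (M k) (n k)

omit [IsLocalRing R] in
lemma jointBRFunction_eq (M : ∀ k, Submodule R (F k)) (n : Fin q → ℕ) :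
    jointBRFunction R F M n =
      relLength (multiPow (symGen M) n) (multiPow (symGen fun _ => ⊤) n) := by
  rw [← symProd_eq_multiPow, ← symProd_eq_multiPow]
  rfl

variable {ρ : Fin q → ℕ} (b : ∀ k, Module.Basis (Unit ⊕ Fin (ρ k)) R (F k))

omit [IsLocalRing R] in
lemma equivMvPolynomial_ι (v : ∀ k, F k) :
    SymmetricAlgebra.equivMvPolynomial (Pi.basis b) (SymmetricAlgebra.ι R (∀ k, F k) v) =
      ∑ j : Σ k, Unit ⊕ Fin (ρ k), (b j.1).repr (v j.1) j.2 • MvPolynomial.X j := by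
  conv_lhs => rw [← (Pi.basis b).sum_repr v, map_sum, map_sum]
  refine Finset.sum_congr rfl fun j _ => ?_
  rw [map_smul, map_smul, SymmetricAlgebra.equivMvPolynomial_ι_apply, Pi.basis_repr]

/-- The total exponent of the distinguished variables of a monomial. -/
def distinguishedDegree (a : (Σ k, Unit ⊕ Fin (ρ k)) →₀ ℕ) : ℕ := ∑ k, a ⟨k, Sum.inl ()⟩

/-- In a linear form from `M k` the distinguished variable has coefficient in `𝔪`; this condition on
coefficients is multiplicative. -/
lemma coeff_mem_pow_of_mem_multiPow {M : ∀ k, Submodule R (F k)}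
    (hb : ∀ k, ∀ x ∈ M k, (b k).repr x (Sum.inl ()) ∈ maximalIdeal R) (n : Fin q → ℕ) :
    ∀ x ∈ multiPow (symGen M) n, ∀ a : (Σ k, Unit ⊕ Fin (ρ k)) →₀ ℕ,
      (SymmetricAlgebra.equivMvPolynomial (Pi.basis b) x).coeff a ∈
        maximalIdeal R ^ distinguishedDegree a := by
  induction n using exponent_induction with
  | h0 =>
    intro x hx a
    rw [multiPow_zero] at hx
    obtain ⟨r, rfl⟩ := Submodule.mem_one.1 hx
    rw [AlgEquiv.commutes, MvPolynomial.algebraMap_eq, MvPolynomial.coeff_C]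
    split_ifs with h
    · subst h
      simp [distinguishedDegree]
    · exact zero_mem _
  | hadd m n hm hn =>
    intro x hx
    rw [multiPow_add] at hx
    induction hx using Submodule.mul_induction_on' with
    | mem_mul_mem x hx y hy =>
      intro a
      rw [map_mul, MvPolynomial.coeff_mul]
      refine sum_mem fun c hc => ?_
      have hdeg : distinguishedDegree a = distinguishedDegree c.1 + distinguishedDegree c.2 := by
        rw [← Finset.HasAntidiagonal.mem_antidiagonal.1 hc]
        simp [distinguishedDegree, Finset.sum_add_distrib]
      rw [hdeg, pow_add]
      exact Ideal.mul_mem_mul (hm x hx _) (hn y hy _)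
    | add x _ y _ hx hy =>
      intro a
      rw [map_add, MvPolynomial.coeff_add]
      exact add_mem (hx a) (hy a)
  | hsingle k =>
    intro x hx a
    rw [multiPow_single] at hx
    obtain ⟨y, hy, rfl⟩ := hx
    rw [LinearMap.comp_apply, equivMvPolynomial_ι, MvPolynomial.coeff_sum]
    refine sum_mem fun j _ => ?_
    rw [MvPolynomial.coeff_smul, MvPolynomial.coeff_X]
    split_ifs with h
    · subst h
      rw [smul_eq_mul, mul_one]
      obtain ⟨l, i⟩ := j
      by_cases hl : l = k
      · subst hl
        rcases i with ⟨⟩ | i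
        · have hdeg : distinguishedDegree (Finsupp.single
              (⟨l, Sum.inl ()⟩ : Σ k, Unit ⊕ Fin (ρ k)) 1) = 1 := by
            unfold distinguishedDegree
            rw [Finset.sum_eq_single l]
            · simp
            · intro k _ hk
              rw [Finsupp.single_apply, if_neg]
              exact fun h => hk (congrArg Sigma.fst h).symm
            · simp
          rw [hdeg, pow_one]
          simpa using hb l y hy
        · have hdeg : distinguishedDegree (Finsupp.single
              (⟨l, Sum.inr i⟩ : Σ k, Unit ⊕ Fin (ρ k)) 1) = 0 := by
            refine Finset.sum_eq_zero fun k _ => ?_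
            rw [Finsupp.single_apply, if_neg]
            intro h
            cases h
          rw [hdeg, pow_zero, Ideal.one_eq_top]
          exact Submodule.mem_top
      · simp [hl]
    · rw [smul_zero]
      exact zero_mem _

omit [IsLocalRing R] in
lemma prod_mem_prod_submodule {A ι : Type*} [CommRing A] [Algebra R A] (s : Finset ι) (x : ι → A)
    (S : ι → Submodule R A) (h : ∀ i ∈ s, x i ∈ S i) : ∏ i ∈ s, x i ∈ ∏ i ∈ s, S i := by
  classical
  induction s using Finset.induction_on with
  | empty => exact Submodule.mem_one.2 ⟨1, by simp⟩
  | insert i s hi ih =>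
    rw [Finset.prod_insert hi, Finset.prod_insert hi]
    exact Submodule.mul_mem_mul (h i (Finset.mem_insert_self i s))
      (ih fun j hj => h j (Finset.mem_insert_of_mem hj))

omit [IsLocalRing R] in
lemma exists_mem_multiPow_eq_monomial (a : (Σ k, Unit ⊕ Fin (ρ k)) →₀ ℕ) (n : Fin q → ℕ)
    (ha : ∀ k, ∑ i, a ⟨k, i⟩ = n k) :
    ∃ z ∈ multiPow (symGen fun _ => ⊤ : Fin q → Submodule R (SymmetricAlgebra R (∀ k, F k))) n,
      SymmetricAlgebra.equivMvPolynomial (Pi.basis b) z = MvPolynomial.monomial a 1 := by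
  refine ⟨∏ k, ∏ i, (SymmetricAlgebra.ι R (∀ k, F k) (LinearMap.single R F k (b k i))) ^ a ⟨k, i⟩,
    prod_mem_prod_submodule _ _ _ fun k _ => ?_, ?_⟩
  · rw [← ha k, ← Finset.prod_pow_eq_pow_sum]
    refine prod_mem_prod_submodule _ _ _ fun i _ => Submodule.pow_mem_pow _ ?_ _
    exact ⟨b k i, Submodule.mem_top, rfl⟩
  · rw [MvPolynomial.monomial_eq, map_one, one_mul, Finsupp.prod_fintype _ _ (by simp),
      Fintype.prod_sigma, map_prod]
    refine Finset.prod_congr rfl fun k _ => ?_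
    rw [map_prod]
    refine Finset.prod_congr rfl fun i _ => ?_
    rw [map_pow]
    congr 1
    rw [← SymmetricAlgebra.equivMvPolynomial_ι_apply (Pi.basis b) ⟨k, i⟩, Pi.basis_apply]
    rfl

/-- The exponents with prescribed total degree `N` in each group of variables and prescribed
exponents of the undistinguished variables. -/
noncomputable def completedExponent (N : ℕ) (β : (Σ k, Fin (ρ k)) → ℕ) :
    (Σ k, Unit ⊕ Fin (ρ k)) →₀ ℕ :=
  Finsupp.equivFunOnFinite.symm fun j =>
    Sum.elim (fun _ => N - ∑ i, β ⟨j.1, i⟩) (fun i => β ⟨j.1, i⟩) j.2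

/-- The undistinguished exponents range freely over `0, …, c`. They sum to at most `(∑ ρ k) * c` in
each group, so total degree `(∑ ρ k + 1) * c` leaves a distinguished exponent of at least `c`.
Reading these coefficients modulo `𝔪 ^ c` kills `M^n` and is onto from `F^n`. -/
lemma le_relLength_multiPow {M : ∀ k, Submodule R (F k)}
    (hb : ∀ k, ∀ x ∈ M k, (b k).repr x (Sum.inl ()) ∈ maximalIdeal R) (hq : 0 < q) (c : ℕ) :
    ((c + 1) ^ (∑ k, ρ k) : ℕ) * Module.length R (R ⧸ maximalIdeal R ^ c) ≤
      relLength (multiPow (symGen M) fun _ => (∑ k, ρ k + 1) * c)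
        (multiPow (symGen fun _ => ⊤) fun _ => (∑ k, ρ k + 1) * c) := by
  classical
  set e := ∑ k, ρ k with he
  let I := (Σ k, Fin (ρ k)) → Fin (c + 1)
  let α : I → (Σ k, Unit ⊕ Fin (ρ k)) →₀ ℕ := fun β =>
    completedExponent ((e + 1) * c) fun j => (β j : ℕ)
  have hsum : ∀ (β : I) k, ∑ i, (β ⟨k, i⟩ : ℕ) ≤ e * c := by
    intro β k
    calc ∑ i, (β ⟨k, i⟩ : ℕ) ≤ ∑ _i : Fin (ρ k), c :=
          Finset.sum_le_sum fun i _ => Nat.lt_succ_iff.1 (β ⟨k, i⟩).2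
      _ = ρ k * c := by simp
      _ ≤ e * c := by
          gcongr
          exact Finset.single_le_sum (f := ρ) (fun _ _ => Nat.zero_le _) (Finset.mem_univ k)
  have hα : ∀ β k, ∑ i, α β ⟨k, i⟩ = (e + 1) * c := by
    intro β k
    have := hsum β k
    simp only [α, completedExponent, Fintype.sum_sum_type,
      Finsupp.equivFunOnFinite_symm_apply_apply, Sum.elim_inl, Sum.elim_inr, Finset.univ_unique, Finset.sum_singleton]
    rw [add_mul]
    omega
  have hαdeg : ∀ β, c ≤ distinguishedDegree (α β) := by
    intro β
    -- One group of variables suffices; `hq` provides it.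
    have := hsum β ⟨0, hq⟩
    refine le_trans ?_ (Finset.single_le_sum (f := fun k => α β ⟨k, Sum.inl ()⟩)
      (fun _ _ => Nat.zero_le _) (Finset.mem_univ ⟨0, hq⟩))
    simp only [α, completedExponent, Finsupp.equivFunOnFinite_symm_apply_apply, Sum.elim_inl]
    rw [add_mul]
    omega
  have hαinj : Function.Injective α := by
    intro β β' h
    ext ⟨k, i⟩
    have := DFunLike.congr_fun h ⟨k, Sum.inr i⟩
    simpa [α, completedExponent] using this
  choose z hz hz' using fun β => exists_mem_multiPow_eq_monomial (R := R) b (α β)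
    (fun _ => (e + 1) * c) (hα β)
  let Φ : SymmetricAlgebra R (∀ k, F k) →ₗ[R] (I → R ⧸ maximalIdeal R ^ c) :=
    LinearMap.pi fun β => (maximalIdeal R ^ c).mkQ ∘ₗ MvPolynomial.lcoeff R (α β) ∘ₗ
      (SymmetricAlgebra.equivMvPolynomial (Pi.basis b)).toLinearMap
  have hΦ : ∀ x β, Φ x β = Ideal.Quotient.mk (maximalIdeal R ^ c)
      ((SymmetricAlgebra.equivMvPolynomial (Pi.basis b) x).coeff (α β)) := fun x β => rfl
  have hker : multiPow (symGen M) (fun _ => (e + 1) * c) ≤ LinearMap.ker Φ := by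
    intro x hx
    ext β
    rw [hΦ, Pi.zero_apply, Ideal.Quotient.eq_zero_iff_mem]
    exact Ideal.pow_le_pow_right (hαdeg β) (coeff_mem_pow_of_mem_multiPow b hb _ x hx _)
  refine le_trans (le_of_eq ?_) (relLength_anti_left _ hker)
  rw [relLength_eq_of_surjective _ _ (Φ ∘ₗ Submodule.subtype _), Module.length_pi]
  · congr 1
    simp [I, he]
  · intro y
    choose r hr using fun β => Ideal.Quotient.mk_surjective (y β)
    refine ⟨∑ β, r β • ⟨z β, hz β⟩, ?_⟩
    ext β
    rw [LinearMap.comp_apply, map_sum, map_sum, Finset.sum_apply, Finset.sum_eq_single β]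
    · simp [hΦ, hz', hr]
    · intro β' _ hβ'
      simp [hΦ, hz', MvPolynomial.coeff_monomial, hαinj.ne hβ']
    · simp
  · rw [LinearMap.ker_comp]
    rfl

end Sharpness

/-! ### The upper bound for the joint Buchsbaum-Rim function -/

section Degree

open IsLocalRing

variable {R : Type*} [CommRing R] [IsLocalRing R] [IsNoetherianRing R] {q : ℕ} {F : Fin q → Type*}
  [∀ k, AddCommGroup (F k)] [∀ k, Module R (F k)]

omit [IsLocalRing R] [IsNoetherianRing R] in
lemma exists_finset_span_eq_symGen_top {ρ : Fin q → ℕ}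
    (b : ∀ k, Module.Basis (Unit ⊕ Fin (ρ k)) R (F k)) (k : Fin q) :
    ∃ s : Finset (SymmetricAlgebra R (∀ k, F k)), s.card ≤ ρ k + 1 ∧
      Submodule.span R (s : Set (SymmetricAlgebra R (∀ k, F k))) = symGen (fun _ => ⊤) k := by
  classical
  refine ⟨Finset.univ.image fun i =>
    (SymmetricAlgebra.ι R (∀ k, F k) ∘ₗ LinearMap.single R F k) (b k i), ?_, ?_⟩
  · refine Finset.card_image_le.trans ?_
    simp [add_comm]
  · rw [Finset.coe_image, Finset.coe_univ, Set.image_univ, symGen, ← (b k).span_eq,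
      Submodule.map_span, ← Set.range_comp]
    rfl

/-- The joint Buchsbaum-Rim function is bounded by a function of the expected growth. -/
lemma exists_jointBRFunction_le {ρ : Fin q → ℕ} (b : ∀ k, Module.Basis (Unit ⊕ Fin (ρ k)) R (F k))
    (M : ∀ k, Submodule R (F k)) (hM : ∀ k, Module.length R (F k ⧸ M k) ≠ ⊤) (d : ℕ)
    (hd : ringKrullDim R = d) (hd0 : 0 < d) :
    ∃ C : ℕ, ∀ n : Fin q → ℕ,
      jointBRFunction R F M n ≤ ((∏ k, (n k + 1) ^ ρ k) * (C * (∑ k, n k) ^ d) : ℕ) := by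
  obtain ⟨c, hc⟩ := exists_length_pow_le d hd hd0
  choose s hs using fun k => exists_pow_smul_mem (M k) (hM k)
  refine ⟨c * (∑ k, s k) ^ d, fun n => ?_⟩
  rw [jointBRFunction_eq]
  refine (relLength_multiPow_le (maximalIdeal R ^ ∑ k, s k) ?_ ρ
    (exists_finset_span_eq_symGen_top b) n).trans ?_
  · rintro k a ha _ ⟨x, -, rfl⟩
    rw [← map_smul]
    exact ⟨a • x, hs k a (Ideal.pow_le_pow_right
      (Finset.single_le_sum (fun _ _ => Nat.zero_le _) (Finset.mem_univ k)) ha) x, rfl⟩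
  · rw [← pow_mul, Nat.cast_mul]
    gcongr
    refine (hc _).trans (le_of_eq ?_)
    push_cast
    ring

end Degree
end JointBR

/-! ### Polynomiality and the exact degree -/

theorem mainTheorem12 {R : Type*} [CommRing R] [IsLocalRing R] [IsNoetherianRing R]
    (d : ℕ) (hd : ringKrullDim R = (d : WithBot ℕ∞)) (hd_pos : 0 < d)
    (q : ℕ) (hq : 0 < q)
    (F : Fin q → Type*) [∀ k, AddCommGroup (F k)] [∀ k, Module R (F k)]
    [∀ k, Module.Free R (F k)] [∀ k, Module.Finite R (F k)]
    (r : Fin q → ℕ) (hr : ∀ k, Module.finrank R (F k) = r k)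
    (M : ∀ k, Submodule R (F k))
    (hM_finite : ∀ k, Module.length R (F k ⧸ M k) ≠ ⊤)
    (hM_nonzero : ∀ k, Module.length R (F k ⧸ M k) ≠ 0) :
    (∀ n : Fin q → ℕ, JointBR.jointBRFunction R F M n ≠ ⊤) ∧
    ∃ p : MvPolynomial (Fin q) ℚ,
      (∃ N : ℕ, ∀ n : Fin q → ℕ, (∀ k, N ≤ n k) →
        ((JointBR.jointBRFunction R F M n).toNat : ℚ) =
          MvPolynomial.eval (fun k => (n k : ℚ)) p) ∧
      (p.totalDegree : ℤ) = (d : ℤ) + (∑ k, (r k : ℤ)) - (q : ℤ) := by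
  have hM_ne : ∀ k, M k ≠ ⊤ := fun k h => hM_nonzero k (by
    rw [Module.length_eq_zero_iff, Submodule.Quotient.subsingleton_iff]
    exact h)
  have hrank : ∀ k, ∃ ρ, Module.finrank R (F k) = ρ + 1 := fun k => by
    have : Nontrivial (F k) := by
      by_contra h
      rw [not_nontrivial_iff_subsingleton] at h
      exact hM_ne k (Subsingleton.elim _ _)
    exact ⟨_, (Nat.succ_pred_eq_of_pos ((Module.finrank_pos_iff_of_free R (F k)).2 this)).symm⟩
  choose ρ hρ using hrank
  choose b hb using fun k =>
    JointBR.exists_basis_repr_mem_maximalIdeal (M k) (hM_ne k) (ρ k) (hρ k)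
  obtain ⟨C, hC⟩ := JointBR.exists_jointBRFunction_le b M hM_finite d hd hd_pos
  have hfin : ∀ n, JointBR.jointBRFunction R F M n ≠ ⊤ := fun n =>
    ne_top_of_le_ne_top (ENat.natCast_ne_top _) (hC n)
  have hC' : ∀ n, (JointBR.jointBRFunction R F M n).toNat ≤
      (∏ k, (n k + 1) ^ ρ k) * (C * (∑ k, n k) ^ d) := fun n => by
    have := ENat.toNat_le_toNat (hC n) (ENat.natCast_ne_top _)
    rwa [ENat.toNat_natCast] at this
  refine ⟨hfin, ?_⟩
  obtain ⟨p, N, hp⟩ := JointBR.exists_mvPolynomial_eq_relLength_multiPow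
    (Ms := JointBR.symGen M) (Fs := JointBR.symGen fun _ => ⊤)
    (fun k => Submodule.map_mono le_top) (fun k => (IsNoetherian.noetherian (M k)).map _)
    (fun k => (IsNoetherian.noetherian _).map _)
    (fun n => by rw [← JointBR.jointBRFunction_eq]; exact hfin n)
  simp_rw [← JointBR.jointBRFunction_eq] at hp
  refine ⟨p, ⟨N, hp⟩, ?_⟩
  have hdeg : p.totalDegree = ∑ k, ρ k + d := by
    refine JointBR.totalDegree_eq_of_growth p _ (fun a ha => ?_) ?_
    -- Starting at `N + 1` ensures `c ≥ 1`, hence `c * a k + 1 ≤ c * (a k + 1)`.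
    · refine ⟨(∏ k, (a k + 1) ^ ρ k) * (C * (∑ k, a k) ^ d) , N + 1, fun c hc => ?_⟩
      have heval := hp (fun k => c * a k) fun k => by
        have := Nat.mul_le_mul (show N ≤ c by omega) (ha k)
        simpa using this
      simp only [Nat.cast_mul] at heval
      rw [← heval, abs_of_nonneg (Nat.cast_nonneg _)]
      have hle := hC' fun k => c * a k
      have hle' : (∏ k, (c * a k + 1) ^ ρ k) * (C * (∑ k, c * a k) ^ d) ≤
          (∏ k, (a k + 1) ^ ρ k) * (C * (∑ k, a k) ^ d) * c ^ (∑ k, ρ k + d) := by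
        calc (∏ k, (c * a k + 1) ^ ρ k) * (C * (∑ k, c * a k) ^ d)
            ≤ (∏ k, (c * (a k + 1)) ^ ρ k) * (C * (∑ k, c * a k) ^ d) := by
              gcongr with k
              rw [mul_add, mul_one]
              omega
          _ = _ := by
              simp_rw [mul_pow, Finset.prod_mul_distrib, Finset.prod_pow_eq_pow_sum,
                ← Finset.mul_sum]
              ring
      exact_mod_cast hle.trans hle'
    · obtain ⟨a, ha, hlow⟩ := JointBR.exists_pow_le_length d hd
      -- The factor `∑ ρ k + 1` comes from the monomial count and `a` from the Hilbert-Samuel bound,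
      -- both applied with the power `𝔪 ^ (a * c)`.
      refine ⟨fun _ => (∑ k, ρ k + 1) * a, a, N + 1, fun c hc => ?_⟩
      have heval := hp (fun k => c * ((∑ k, ρ k + 1) * a)) fun k => by
        have h1 : 1 ≤ (∑ k, ρ k + 1) * a := Nat.mul_pos (Nat.succ_pos _) ha
        have := Nat.mul_le_mul (show N ≤ c by omega) h1
        simpa using this
      have hcast : MvPolynomial.eval
          (fun _ : Fin q => (c : ℚ) * (((∑ k, ρ k + 1) * a : ℕ) : ℚ)) p =
          ((JointBR.jointBRFunction R F M fun _ => c * ((∑ k, ρ k + 1) * a)).toNat : ℚ) := by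
        rw [heval]
        simp only [Nat.cast_mul]
      rw [hcast, abs_of_nonneg (Nat.cast_nonneg _)]
      have h1 := JointBR.le_relLength_multiPow b hb hq (a * c)
      rw [← JointBR.jointBRFunction_eq] at h1
      have harg : (∑ k, ρ k + 1) * (a * c) = c * ((∑ k, ρ k + 1) * a) := by ring
      rw [harg] at h1
      have h2 : ((c ^ (∑ k, ρ k + d) : ℕ) : ℕ∞) ≤
          a * JointBR.jointBRFunction R F M fun _ => c * ((∑ k, ρ k + 1) * a) := by
        calc ((c ^ (∑ k, ρ k + d) : ℕ) : ℕ∞)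
            = (c ^ (∑ k, ρ k) : ℕ) * (c ^ d : ℕ∞) := by push_cast; rw [pow_add]
          _ ≤ ((a * c + 1) ^ (∑ k, ρ k) : ℕ) *
              (a * Module.length R (R ⧸ IsLocalRing.maximalIdeal R ^ (a * c))) := by
              gcongr
              · nlinarith
              · exact hlow c (by omega)
          _ = a * (((a * c + 1) ^ (∑ k, ρ k) : ℕ) *
              Module.length R (R ⧸ IsLocalRing.maximalIdeal R ^ (a * c))) := mul_left_comm _ _ _
          _ ≤ _ := by gcongr
      rw [← ENat.natCast_toNat (hfin fun _ => c * ((∑ k, ρ k + 1) * a))] at h2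
      exact_mod_cast h2
  rw [hdeg]
  have hsum : ∑ k, (r k : ℤ) = ∑ k, (ρ k : ℤ) + q := by
    simp_rw [← hr, hρ]
    push_cast
    simp [Finset.sum_add_distrib]
  rw [hsum]
  push_cast
  ring
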